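/- Let $R$ and $S$ be (associative, unital) rings; ${}_R\mathcal M$, $\mathcal M_R$, ${}_R\mathcal M_S$ denote the categories of left $R$-modules, right $R$-modules and $(R,S)$-bimodules. A pair of functors $F:\mathcal C\to\mathcal D$, $G:\mathcal D\to\mathcal C$ is an $(\alpha,\beta)$-Frobenius pair, for $\alpha:\mathcal C\to\mathcal C$ and $\beta:\mathcal D\to\mathcal D$, if $G$ is a right adjoint of $F$ and a left adjoint of $\beta F\alpha$. A functor $F$ is a Frobenius functor of the second kind if it belongs to an $(\alpha,\beta)$-Frobenius pair $(F,G)$ for some category equivalences $\alpha,\beta$; a Frobenius datum between $\mathcal C$ and $\mathcal D$ is such a functor together with a choice of $(G,\alpha,\beta)$, and two data are identified if their four functors are respectively naturally isomorphic. A Morita context on $R$ is $\underline U=(R,R,U,U',f,f')$ with $U,U'\in{}_R\mathcal M_R$ and bimodule maps $f:U\otimes_RU'\to R$, $f':U'\otimes_RU\to R$ such that $f(u\otimes u')v=u\,f'(u'\otimes v)$ and $f'(u'\otimes u)v'=u'f(u\otimes v')$; it is strict if $f$ and $f'$ are bijective. Similarly $\underline V=(S,S,V,V',g,g')$ on $S$.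 Isomorphisms of Morita contexts are pairs of bimodule isomorphisms compatible with the two pairings. **Theorem 2.4.** (a) For $X\in{}_R\mathcal M_S$, $\Lambda\in{}_S\mathcal M_R$ and strict Morita contexts $\underline U$ on $R$ and $\underline V$ on $S$, the following conditions are equivalent: i) $X$ is finitely generated projective as a left $R$-module and as a right $S$-module, and there are $(S,R)$-bimodule isomorphisms $$\Lambda\cong\mathrm{Hom}_S(X,S)\cong V'\otimes_S{}_R\mathrm{Hom}(X,R)\otimes_RU';$$ ii) $\Lambda$ is finitely generated projective as a left $S$-module and as a right $R$-module, and there are $(R,S)$-bimodule isomorphisms $$X\cong{}_S\mathrm{Hom}(\Lambda,S)\cong\mathrm{Hom}_R(V\otimes_S\Lambda\otimes_RU,R).$$ (b) There are one-to-one correspondences between 1. Frobenius data $(F,G,\alpha,\beta)$ between ${}_R\mathcal M$ and ${}_S\mathcal M$, up to natural isomorphism; 2. Frobenius data $(F',G',\alpha',\beta')$ between $\mathcal M_R$ and $\mathcal M_S$, up to natural isomorphism; 3. fourtuples $(X,\Lambda,\underline U,\underline V)$, with $X\in{}_R\mathcal M_S$, $\Lambda\in{}_S\mathcal M_R$ and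 strict Morita contexts $\underline U$ on $R$ and $\underline V$ on $S$, satisfying the equivalent conditions of (a), up to isomorphism in each component. They match $(X,\Lambda,\underline U,\underline V)$ with $$(F,G,\alpha,\beta)=(\Lambda\otimes_R\bullet,\;X\otimes_S\bullet,\;U\otimes_R\bullet,\;V\otimes_S\bullet)$$ and $$(F',G',\alpha',\beta')=(\bullet\otimes_RX,\;\bullet\otimes_S\Lambda,\;\bullet\otimes_RU,\;\bullet\otimes_SV).$$ (c) Forgetting $(G,\alpha,\beta)$, this induces a one-to-one correspondence between isomorphism classes of Frobenius functors of the second kind ${}_R\mathcal M\to{}_S\mathcal M$ and isomorphism classes of Frobenius functors of the second kind $\mathcal M_R\to\mathcal M_S$: a functor $F$ corresponds to a functor $F'$ if and only if $F\cong\Lambda\otimes_R\bullet$ and $F'\cong\bullet\otimes_RX$ for some fourtuple as in (b). -/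

import Mathlib

open CategoryTheory MulOpposite
open scoped TensorProduct

universe u

/-! Throughout, a right `B`-module is a module over `Bᵐᵒᵖ`; the right action `m * b` is
`op b • m`. The category of right `B`-modules is `ModuleCat Bᵐᵒᵖ`. -/

section BalancedTensor

variable (B : Type u) [Ring B]

/-- The subgroup of `M ⊗[ℤ] N` generated by the elements `m b ⊗ n - m ⊗ b n`. -/
def balancingSubgroup (M N : Type u) [AddCommGroup M] [Module Bᵐᵒᵖ M]
    [AddCommGroup N] [Module B N] : AddSubgroup (M ⊗[ℤ] N) :=
  AddSubgroup.closure
    {t | ∃ (m : M) (b : B) (n : N), t = (op b • m) ⊗ₜ[ℤ] n - m ⊗ₜ[ℤ] (b • n)}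

/-- The tensor product `M ⊗_B N` of a right module and a left module over a ring `B` that
need not be commutative; it is an abelian group. -/
def BTensor (M N : Type u) [AddCommGroup M] [Module Bᵐᵒᵖ M]
    [AddCommGroup N] [Module B N] : Type u :=
  (M ⊗[ℤ] N) ⧸ balancingSubgroup B M N

namespace BTensor

variable {M N M' N' M'' N'' : Type u}
  [AddCommGroup M] [Module Bᵐᵒᵖ M] [AddCommGroup N] [Module B N]
  [AddCommGroup M'] [Module Bᵐᵒᵖ M'] [AddCommGroup N'] [Module B N']
  [AddCommGroup M''] [Module Bᵐᵒᵖ M''] [AddCommGroup N''] [Module B N'']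

instance : AddCommGroup (BTensor B M N) :=
  inferInstanceAs (AddCommGroup ((M ⊗[ℤ] N) ⧸ balancingSubgroup B M N))

variable (M N) in
/-- The quotient map `M ⊗[ℤ] N → M ⊗_B N`. -/
def mk : M ⊗[ℤ] N →+ BTensor B M N :=
  QuotientAddGroup.mk' (balancingSubgroup B M N)

/-- The pure tensor `m ⊗_B n`. -/
def tmul (m : M) (n : N) : BTensor B M N :=
  mk B M N (m ⊗ₜ[ℤ] n)

theorem smul_tmul (m : M) (b : B) (n : N) : tmul B (op b • m) n = tmul B m (b • n) := by
  rw [← sub_eq_zero]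
  unfold tmul
  rw [← map_sub]
  exact (QuotientAddGroup.eq_zero_iff _).2 (AddSubgroup.subset_closure ⟨m, b, n, rfl⟩)

theorem add_tmul (m m' : M) (n : N) : tmul B (m + m') n = tmul B m n + tmul B m' n := by
  simp only [tmul, TensorProduct.add_tmul, map_add]

theorem tmul_add (m : M) (n n' : N) : tmul B m (n + n') = tmul B m n + tmul B m n' := by
  simp only [tmul, TensorProduct.tmul_add, map_add]

theorem induction_on {p : BTensor B M N → Prop} (z : BTensor B M N) (zero : p 0)
    (tmul : ∀ m n, p (tmul B m n)) (add : ∀ x y, p x → p y → p (x + y)) : p z := by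
  obtain ⟨t, rfl⟩ : ∃ t, mk B M N t = z := QuotientAddGroup.mk'_surjective _ z
  induction t using TensorProduct.induction_on with
  | zero => simpa only [map_zero] using zero
  | tmul m n => exact tmul m n
  | add x y hx hy => simpa only [map_add] using add _ _ hx hy

theorem hom_ext {P : Type*} [AddCommGroup P] {f g : BTensor B M N →+ P}
    (h : ∀ m n, f (tmul B m n) = g (tmul B m n)) : f = g := by
  ext z
  induction z using BTensor.induction_on with
  | zero => simp
  | tmul m n => exact h m n
  | add x y hx hy => simp [hx, hy]

/-- The map `f ⊗_B g` on tensor products. -/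
def map (f : M →ₗ[Bᵐᵒᵖ] M') (g : N →ₗ[B] N') : BTensor B M N →+ BTensor B M' N' :=
  QuotientAddGroup.map (balancingSubgroup B M N) (balancingSubgroup B M' N')
    (TensorProduct.map f.toAddMonoidHom.toIntLinearMap
      g.toAddMonoidHom.toIntLinearMap).toAddMonoidHom (by
    refine (AddSubgroup.closure_le _).2 ?_
    rintro _ ⟨m, b, n, rfl⟩
    refine AddSubgroup.subset_closure ⟨f m, b, g n, ?_⟩
    simp)

@[simp] theorem map_tmul (f : M →ₗ[Bᵐᵒᵖ] M') (g : N →ₗ[B] N') (m : M) (n : N) :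
    map B f g (tmul B m n) = tmul B (f m) (g n) := rfl

theorem map_id : map B (LinearMap.id : M →ₗ[Bᵐᵒᵖ] M) (LinearMap.id : N →ₗ[B] N) =
    AddMonoidHom.id _ := hom_ext B fun _ _ => rfl

theorem map_comp (f : M →ₗ[Bᵐᵒᵖ] M') (f' : M' →ₗ[Bᵐᵒᵖ] M'') (g : N →ₗ[B] N')
    (g' : N' →ₗ[B] N'') :
    map B (f' ∘ₗ f) (g' ∘ₗ g) = (map B f' g').comp (map B f g) := hom_ext B fun _ _ => rfl

theorem map_add_left (f f' : M →ₗ[Bᵐᵒᵖ] M') (g : N →ₗ[B] N') :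
    map B (f + f') g = map B f g + map B f' g := hom_ext B fun m n => by
  simp [add_tmul]

theorem map_add_right (f : M →ₗ[Bᵐᵒᵖ] M') (g g' : N →ₗ[B] N') :
    map B f (g + g') = map B f g + map B f g' := hom_ext B fun m n => by
  simp [tmul_add]

theorem map_zero_left (g : N →ₗ[B] N') : map B (0 : M →ₗ[Bᵐᵒᵖ] M') g = 0 := by
  simpa using map_add_left B (0 : M →ₗ[Bᵐᵒᵖ] M') 0 g

theorem map_zero_right (f : M →ₗ[Bᵐᵒᵖ] M') : map B f (0 : N →ₗ[B] N') = 0 := by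
  simpa using map_add_right B f (0 : N →ₗ[B] N') 0

end BTensor

end BalancedTensor

section Bimodules

/-- An `(A, B)`-bimodule: a left `A`-module and right `B`-module with commuting actions. -/
structure RBimod (A B : Type u) [Ring A] [Ring B] where
  carrier : Type u
  [addCommGroup : AddCommGroup carrier]
  [leftModule : Module A carrier]
  [rightModule : Module Bᵐᵒᵖ carrier]
  [comm : SMulCommClass A Bᵐᵒᵖ carrier]

namespace RBimod

variable {A B C : Type u} [Ring A] [Ring B] [Ring C]

instance : CoeSort (RBimod A B) (Type u) := ⟨RBimod.carrier⟩

attribute [instance] addCommGroup leftModule rightModule comm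

/-- Homomorphisms of bimodules. -/
structure Hom (M N : RBimod A B) extends M →+ N where
  map_smul' : ∀ (a : A) (m : M), toFun (a • m) = a • toFun m
  map_op_smul' : ∀ (b : Bᵐᵒᵖ) (m : M), toFun (b • m) = b • toFun m

instance (M N : RBimod A B) : CoeFun (Hom M N) (fun _ => M → N) := ⟨fun f => f.toFun⟩

/-- Isomorphisms of bimodules. -/
structure Iso (M N : RBimod A B) extends M ≃+ N where
  map_smul' : ∀ (a : A) (m : M), toFun (a • m) = a • toFun m
  map_op_smul' : ∀ (b : Bᵐᵒᵖ) (m : M), toFun (b • m) = b • toFun m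

namespace Iso

instance (M N : RBimod A B) : CoeFun (Iso M N) (fun _ => M → N) := ⟨fun f => f.toFun⟩

/-- The identity isomorphism. -/
def refl (M : RBimod A B) : Iso M M :=
  { AddEquiv.refl M with map_smul' := fun _ _ => rfl, map_op_smul' := fun _ _ => rfl }

/-- The inverse isomorphism. -/
def symm {M N : RBimod A B} (e : Iso M N) : Iso N M :=
  { e.toAddEquiv.symm with
    map_smul' := fun a n => e.toAddEquiv.injective <| by
      change e.toAddEquiv (e.toAddEquiv.symm (a • n)) = e.toFun (a • e.toAddEquiv.symm n)
      rw [e.map_smul']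
      exact (e.toAddEquiv.apply_symm_apply _).trans
        (congrArg (a • ·) (e.toAddEquiv.apply_symm_apply n).symm)
    map_op_smul' := fun b n => e.toAddEquiv.injective <| by
      change e.toAddEquiv (e.toAddEquiv.symm (b • n)) = e.toFun (b • e.toAddEquiv.symm n)
      rw [e.map_op_smul']
      exact (e.toAddEquiv.apply_symm_apply _).trans
        (congrArg (b • ·) (e.toAddEquiv.apply_symm_apply n).symm) }

/-- Composition of isomorphisms. -/
def trans {M N P : RBimod A B} (e : Iso M N) (e' : Iso N P) : Iso M P :=
  { e.toAddEquiv.trans e'.toAddEquiv with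
    map_smul' := fun a m =>
      (congrArg e'.toFun (e.map_smul' a m)).trans (e'.map_smul' a (e.toFun m))
    map_op_smul' := fun b m =>
      (congrArg e'.toFun (e.map_op_smul' b m)).trans (e'.map_op_smul' b (e.toFun m)) }

/-- The underlying isomorphism of left modules. -/
def toLeftLinear {M N : RBimod A B} (e : Iso M N) : M →ₗ[A] N where
  toFun := e.toFun
  map_add' := e.map_add'
  map_smul' := e.map_smul'

/-- The underlying isomorphism of right modules. -/
def toRightLinear {M N : RBimod A B} (e : Iso M N) : M →ₗ[Bᵐᵒᵖ] N where
  toFun := e.toFun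
  map_add' := e.map_add'
  map_smul' := e.map_op_smul'

end Iso

/-- The regular bimodule `A`. -/
def self (A : Type u) [Ring A] : RBimod A A where
  carrier := A

/-- Left multiplication by `a`, as a right linear endomorphism. -/
def leftMul (M : RBimod A B) (a : A) : M →ₗ[Bᵐᵒᵖ] M where
  toFun m := a • m
  map_add' := smul_add a
  map_smul' b m := smul_comm a b m

/-- Right multiplication by `b`, as a left linear endomorphism. -/
def rightMul (M : RBimod A B) (b : Bᵐᵒᵖ) : M →ₗ[A] M where
  toFun m := b • m
  map_add' := smul_add b
  map_smul' a m := (smul_comm a b m).symm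

/-- For an `(A, B)`-bimodule `M` and a left `B`-module `N`, the left `A`-module structure
`a (m ⊗ n) = a m ⊗ n` on `M ⊗_B N`. -/
instance tensorLeftModule (M : RBimod A B) (N : Type u) [AddCommGroup N] [Module B N] :
    Module A (BTensor B M N) where
  smul a := BTensor.map B (M.leftMul a) LinearMap.id
  one_smul z := by
    change BTensor.map B (M.leftMul 1) LinearMap.id z = z
    have : M.leftMul 1 = LinearMap.id := LinearMap.ext fun m => one_smul A m
    rw [this, BTensor.map_id]; rfl
  mul_smul a a' z := by
    change BTensor.map B (M.leftMul (a * a')) LinearMap.id z = _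
    have : M.leftMul (a * a') = M.leftMul a ∘ₗ M.leftMul a' :=
      LinearMap.ext fun m => mul_smul a a' m
    rw [this, ← LinearMap.id_comp (LinearMap.id : N →ₗ[B] N), BTensor.map_comp]; rfl
  smul_zero a := map_zero (BTensor.map B (M.leftMul a) LinearMap.id)
  smul_add a := map_add (BTensor.map B (M.leftMul a) LinearMap.id)
  add_smul a a' z := by
    change BTensor.map B (M.leftMul (a + a')) LinearMap.id z = _
    have : M.leftMul (a + a') = M.leftMul a + M.leftMul a' :=
      LinearMap.ext fun m => add_smul a a' m
    rw [this, BTensor.map_add_left]; rfl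
  zero_smul z := by
    change BTensor.map B (M.leftMul 0) LinearMap.id z = 0
    have : M.leftMul 0 = 0 := LinearMap.ext fun m => zero_smul A m
    rw [this, BTensor.map_zero_left]; rfl

/-- For a right `B`-module `M` and a `(B, C)`-bimodule `N`, the right `C`-module structure
`(m ⊗ n) c = m ⊗ n c` on `M ⊗_B N`. -/
instance tensorRightModule (M : Type u) [AddCommGroup M] [Module Bᵐᵒᵖ M] (N : RBimod B C) :
    Module Cᵐᵒᵖ (BTensor B M N) where
  smul c := BTensor.map B LinearMap.id (N.rightMul c)
  one_smul z := by
    change BTensor.map B LinearMap.id (N.rightMul 1) z = z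
    have : N.rightMul 1 = LinearMap.id := LinearMap.ext fun n => one_smul Cᵐᵒᵖ n
    rw [this, BTensor.map_id]; rfl
  mul_smul c c' z := by
    change BTensor.map B LinearMap.id (N.rightMul (c * c')) z = _
    have : N.rightMul (c * c') = N.rightMul c ∘ₗ N.rightMul c' :=
      LinearMap.ext fun n => mul_smul c c' n
    rw [this, ← LinearMap.id_comp (LinearMap.id : M →ₗ[Bᵐᵒᵖ] M), BTensor.map_comp]; rfl
  smul_zero c := map_zero (BTensor.map B LinearMap.id (N.rightMul c))
  smul_add c := map_add (BTensor.map B LinearMap.id (N.rightMul c))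
  add_smul c c' z := by
    change BTensor.map B LinearMap.id (N.rightMul (c + c')) z = _
    have : N.rightMul (c + c') = N.rightMul c + N.rightMul c' :=
      LinearMap.ext fun n => add_smul c c' n
    rw [this, BTensor.map_add_right]; rfl
  zero_smul z := by
    change BTensor.map B LinearMap.id (N.rightMul 0) z = 0
    have : N.rightMul 0 = 0 := LinearMap.ext fun n => zero_smul Cᵐᵒᵖ n
    rw [this, BTensor.map_zero_right]; rfl

/-- The tensor product of bimodules. -/
def tensor (M : RBimod A B) (N : RBimod B C) : RBimod A C where
  carrier := BTensor B M N
  addCommGroup := inferInstance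
  leftModule := tensorLeftModule M N
  rightModule := tensorRightModule M N
  comm := ⟨fun a c z => DFunLike.congr_fun (BTensor.hom_ext B
      (f := (BTensor.map B (M.leftMul a) (LinearMap.id : N →ₗ[B] N)).comp
        (BTensor.map B LinearMap.id (N.rightMul c)))
      (g := (BTensor.map B LinearMap.id (N.rightMul c)).comp
        (BTensor.map B (M.leftMul a) LinearMap.id)) fun _ _ => rfl) z⟩

/-- The right `A`-action `(f a)(m) = f(a m)` on `Hom_B(M, B)`. -/
@[reducible] def rightDualModule (M : RBimod A B) : Module Aᵐᵒᵖ (M →ₗ[Bᵐᵒᵖ] B) :=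
  letI : SMul Aᵐᵒᵖ (M →ₗ[Bᵐᵒᵖ] B) := ⟨fun a f => f ∘ₗ M.leftMul a.unop⟩
  { one_smul := fun f => LinearMap.ext fun m => congrArg f (one_smul A m)
    mul_smul := fun a a' f => LinearMap.ext fun m => congrArg f (mul_smul a'.unop a.unop m)
    smul_zero := fun _ => rfl
    smul_add := fun _ _ _ => rfl
    add_smul := fun a a' f => LinearMap.ext fun m =>
      (congrArg f (add_smul a.unop a'.unop m)).trans (map_add f _ _)
    zero_smul := fun f => LinearMap.ext fun m =>
      (congrArg f (zero_smul A m)).trans (map_zero f) }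

/-- The dual `Hom_B(M, B)` of right linear maps, a `(B, A)`-bimodule by
`(b f)(m) = b f(m)` and `(f a)(m) = f(a m)`. -/
def rightDual (M : RBimod A B) : RBimod B A where
  carrier := M →ₗ[Bᵐᵒᵖ] B
  addCommGroup := inferInstance
  leftModule := inferInstance
  rightModule := M.rightDualModule
  comm := letI := M.rightDualModule; ⟨fun _ _ _ => rfl⟩

/-- The left `B`-action `(b f)(m) = f(m b)` on `_AHom(M, A)`. -/
@[reducible] def leftDualModule (M : RBimod A B) : Module B (M →ₗ[A] A) :=
  letI : SMul B (M →ₗ[A] A) := ⟨fun b f => f ∘ₗ M.rightMul (op b)⟩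
  { one_smul := fun f => LinearMap.ext fun m => congrArg f (one_smul Bᵐᵒᵖ m)
    mul_smul := fun b b' f => LinearMap.ext fun m =>
      congrArg f (mul_smul (op b') (op b) m)
    smul_zero := fun _ => rfl
    smul_add := fun _ _ _ => rfl
    add_smul := fun b b' f => LinearMap.ext fun m =>
      (congrArg f (add_smul (op b) (op b') m)).trans (map_add f _ _)
    zero_smul := fun f => LinearMap.ext fun m =>
      (congrArg f (zero_smul Bᵐᵒᵖ m)).trans (map_zero f) }

/-- The dual `_AHom(M, A)` of left linear maps, a `(B, A)`-bimodule by
`(b f)(m) = f(m b)` and `(f a)(m) = f(m) a`. -/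
def leftDual (M : RBimod A B) : RBimod B A where
  carrier := M →ₗ[A] A
  addCommGroup := inferInstance
  leftModule := M.leftDualModule
  rightModule := inferInstance
  comm := letI := M.leftDualModule; ⟨fun _ _ _ => rfl⟩

/-- Finitely generated and projective both as a left and as a right module. -/
def FGProjTwoSided (M : RBimod A B) : Prop :=
  (Module.Finite A M ∧ Module.Projective A M) ∧
    Module.Finite Bᵐᵒᵖ M ∧ Module.Projective Bᵐᵒᵖ M

/-- The functor `M ⊗_B -` from left `B`-modules to left `A`-modules. -/
def tensorLeftFunctor (M : RBimod A B) : ModuleCat.{u} B ⥤ ModuleCat.{u} A where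
  obj N := ModuleCat.of A (BTensor B M N)
  map {N N'} g := ModuleCat.ofHom
    { toFun := BTensor.map B (LinearMap.id : M →ₗ[Bᵐᵒᵖ] M) g.hom
      map_add' := map_add _
      map_smul' := fun a z => DFunLike.congr_fun (BTensor.hom_ext B
        (f := (BTensor.map B LinearMap.id g.hom).comp
          (BTensor.map B (M.leftMul a) LinearMap.id))
        (g := (BTensor.map B (M.leftMul a) LinearMap.id).comp
          (BTensor.map B LinearMap.id g.hom)) fun _ _ => rfl) z }
  map_id N := by
    ext z
    exact DFunLike.congr_fun (BTensor.map_id B (M := M) (N := N)) z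
  map_comp {N N' N''} g g' := by
    ext z
    exact DFunLike.congr_fun
      (BTensor.map_comp B (LinearMap.id : M →ₗ[Bᵐᵒᵖ] M) LinearMap.id g.hom g'.hom) z

/-- The functor `- ⊗_A M` from right `A`-modules to right `B`-modules. -/
def tensorRightFunctor (M : RBimod A B) : ModuleCat.{u} Aᵐᵒᵖ ⥤ ModuleCat.{u} Bᵐᵒᵖ where
  obj N := ModuleCat.of Bᵐᵒᵖ (BTensor A N M)
  map {N N'} g := ModuleCat.ofHom
    { toFun := BTensor.map A g.hom (LinearMap.id : M →ₗ[A] M)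
      map_add' := map_add _
      map_smul' := fun b z => DFunLike.congr_fun (BTensor.hom_ext A
        (f := (BTensor.map A g.hom LinearMap.id).comp
          (BTensor.map A LinearMap.id (M.rightMul b)))
        (g := (BTensor.map A LinearMap.id (M.rightMul b)).comp
          (BTensor.map A g.hom LinearMap.id)) fun _ _ => rfl) z }
  map_id N := by
    ext z
    exact DFunLike.congr_fun (BTensor.map_id A (M := N) (N := M)) z
  map_comp {N N' N''} g g' := by
    ext z
    exact DFunLike.congr_fun
      (BTensor.map_comp A g.hom g'.hom (LinearMap.id : M →ₗ[A] M) LinearMap.id) z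

end RBimod

/-- A Morita context `(A, B, P, Q, f, g)`: bimodule maps `f : P ⊗_B Q → A` and
`g : Q ⊗_A P → B` satisfying the two associativity conditions. -/
structure MoritaContext (A B : Type u) [Ring A] [Ring B] where
  P : RBimod A B
  Q : RBimod B A
  f : RBimod.Hom (P.tensor Q) (RBimod.self A)
  g : RBimod.Hom (Q.tensor P) (RBimod.self B)
  /-- `f(p ⊗ q) p' = p g(q ⊗ p')` -/
  assoc_left : ∀ (p : P) (q : Q) (p' : P),
    P.leftMul (f (BTensor.tmul B p q)) p' = P.rightMul (op (g (BTensor.tmul A q p'))) p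
  /-- `g(q ⊗ p) q' = q f(p ⊗ q')` -/
  assoc_right : ∀ (q : Q) (p : P) (q' : Q),
    Q.leftMul (g (BTensor.tmul A q p)) q' = Q.rightMul (op (f (BTensor.tmul B p q'))) q

namespace MoritaContext

variable {A B : Type u} [Ring A] [Ring B]

/-- A Morita context is strict if both of its pairings are isomorphisms. -/
def IsStrict (U : MoritaContext A B) : Prop :=
  Function.Bijective U.f ∧ Function.Bijective U.g

/-- Two Morita contexts are isomorphic if there are bimodule isomorphisms between their
bimodules that are compatible with the pairings. -/
def Isomorphic (U W : MoritaContext A B) : Prop :=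
  ∃ (e : RBimod.Iso U.P W.P) (e' : RBimod.Iso U.Q W.Q),
    (∀ (p : U.P) (q : U.Q),
      W.f (BTensor.tmul B (e p) (e' q)) = U.f (BTensor.tmul B p q)) ∧
    ∀ (q : U.Q) (p : U.P),
      W.g (BTensor.tmul A (e' q) (e p)) = U.g (BTensor.tmul A q p)

theorem Isomorphic.refl (U : MoritaContext A B) : Isomorphic U U :=
  ⟨RBimod.Iso.refl _, RBimod.Iso.refl _, fun _ _ => rfl, fun _ _ => rfl⟩

theorem Isomorphic.symm {U W : MoritaContext A B} : Isomorphic U W → Isomorphic W U := by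
  rintro ⟨e, e', h, h'⟩
  have he (p : W.P) : e (e.symm p) = p := e.toAddEquiv.apply_symm_apply p
  have he' (q : W.Q) : e' (e'.symm q) = q := e'.toAddEquiv.apply_symm_apply q
  refine ⟨e.symm, e'.symm, fun p q => ?_, fun q p => ?_⟩
  · rw [← h, he, he']
  · rw [← h', he, he']

theorem Isomorphic.trans {U W Z : MoritaContext A B} :
    Isomorphic U W → Isomorphic W Z → Isomorphic U Z := by
  rintro ⟨e, e', h, h'⟩ ⟨d, d', k, k'⟩
  exact ⟨e.trans d, e'.trans d', fun p q => (k _ _).trans (h p q),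
    fun q p => (k' _ _).trans (h' q p)⟩

end MoritaContext

end Bimodules

section FrobeniusFunctors

/-- `(F, G)` is an `(α, β)`-Frobenius pair: `G` is a right adjoint of `F` and a left adjoint
of `β F α`. -/
def IsFrobeniusPair {C D : Type*} [Category C] [Category D]
    (F : C ⥤ D) (G : D ⥤ C) (α : C ⥤ C) (β : D ⥤ D) : Prop :=
  Nonempty (F ⊣ G) ∧ Nonempty (G ⊣ α ⋙ F ⋙ β)

/-- `F` is a Frobenius functor of the second kind: it belongs to an `(α, β)`-Frobenius pair
`(F, G)` for some category equivalences `α` and `β`. -/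
def IsFrobeniusSecondKind {C D : Type*} [Category C] [Category D] (F : C ⥤ D) : Prop :=
  ∃ (G : D ⥤ C) (α : C ⥤ C) (β : D ⥤ D),
    α.IsEquivalence ∧ β.IsEquivalence ∧ IsFrobeniusPair F G α β

/-- Frobenius functors of the second kind together with the functors `G`, `α`, `β` that
exhibit them as such. -/
structure FrobeniusDatum (C D : Type*) [Category C] [Category D] where
  F : C ⥤ D
  G : D ⥤ C
  α : C ⥤ C
  β : D ⥤ D
  equivα : α.IsEquivalence
  equivβ : β.IsEquivalence
  frobenius : IsFrobeniusPair F G α β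

/-- Componentwise natural isomorphism. -/
instance FrobeniusDatum.setoid (C D : Type*) [Category C] [Category D] :
    Setoid (FrobeniusDatum C D) where
  r X Y := Nonempty (X.F ≅ Y.F) ∧ Nonempty (X.G ≅ Y.G) ∧
    Nonempty (X.α ≅ Y.α) ∧ Nonempty (X.β ≅ Y.β)
  iseqv :=
    { refl := fun _ => ⟨⟨Iso.refl _⟩, ⟨Iso.refl _⟩, ⟨Iso.refl _⟩, ⟨Iso.refl _⟩⟩
      symm := fun ⟨⟨a⟩, ⟨b⟩, ⟨c⟩, ⟨d⟩⟩ => ⟨⟨a.symm⟩, ⟨b.symm⟩, ⟨c.symm⟩, ⟨d.symm⟩⟩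
      trans := fun ⟨⟨a⟩, ⟨b⟩, ⟨c⟩, ⟨d⟩⟩ ⟨⟨a'⟩, ⟨b'⟩, ⟨c'⟩, ⟨d'⟩⟩ =>
        ⟨⟨a ≪≫ a'⟩, ⟨b ≪≫ b'⟩, ⟨c ≪≫ c'⟩, ⟨d ≪≫ d'⟩⟩ }

/-- Single Frobenius functors of the second kind. -/
def FrobeniusFunctor (C D : Type*) [Category C] [Category D] :=
  {F : C ⥤ D // IsFrobeniusSecondKind F}

/-- Natural isomorphism. -/
instance FrobeniusFunctor.setoid (C D : Type*) [Category C] [Category D] :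
    Setoid (FrobeniusFunctor C D) where
  r X Y := Nonempty (X.1 ≅ Y.1)
  iseqv :=
    { refl := fun _ => ⟨Iso.refl _⟩
      symm := fun ⟨a⟩ => ⟨a.symm⟩
      trans := fun ⟨a⟩ ⟨b⟩ => ⟨a ≪≫ b⟩ }

end FrobeniusFunctors

section Fourtuples

variable {R S : Type u} [Ring R] [Ring S]

/-- `X` is finitely generated projective on both sides, and
`Λ ≅ Hom_S(X, S) ≅ V' ⊗_S _RHom(X, R) ⊗_R U'` as `(S, R)`-bimodules. -/
def FrobeniusConditionX (X : RBimod R S) (Λ : RBimod S R)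
    (U : MoritaContext R R) (V : MoritaContext S S) : Prop :=
  X.FGProjTwoSided ∧ Nonempty (RBimod.Iso Λ X.rightDual) ∧
    Nonempty (RBimod.Iso X.rightDual (V.Q.tensor (X.leftDual.tensor U.Q)))

/-- `Λ` is finitely generated projective on both sides, and
`X ≅ _SHom(Λ, S) ≅ Hom_R(V ⊗_S Λ ⊗_R U, R)` as `(R, S)`-bimodules. -/
def FrobeniusConditionΛ (X : RBimod R S) (Λ : RBimod S R)
    (U : MoritaContext R R) (V : MoritaContext S S) : Prop :=
  Λ.FGProjTwoSided ∧ Nonempty (RBimod.Iso X Λ.leftDual) ∧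
    Nonempty (RBimod.Iso Λ.leftDual (V.P.tensor (Λ.tensor U.P)).rightDual)

variable (R S) in
/-- Fourtuples `(X, Λ, U, V)` with `U`, `V` strict Morita contexts. -/
structure FrobeniusFourtuple where
  X : RBimod R S
  Λ : RBimod S R
  U : MoritaContext R R
  V : MoritaContext S S
  strictU : U.IsStrict
  strictV : V.IsStrict
  condition : FrobeniusConditionX X Λ U V

variable (R S) in
/-- Componentwise isomorphism. -/
instance FrobeniusFourtuple.setoid : Setoid (FrobeniusFourtuple R S) where
  r t t' := Nonempty (RBimod.Iso t.X t'.X) ∧ Nonempty (RBimod.Iso t.Λ t'.Λ) ∧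
    t.U.Isomorphic t'.U ∧ t.V.Isomorphic t'.V
  iseqv :=
    { refl := fun _ => ⟨⟨RBimod.Iso.refl _⟩, ⟨RBimod.Iso.refl _⟩,
        MoritaContext.Isomorphic.refl _, MoritaContext.Isomorphic.refl _⟩
      symm := fun ⟨⟨a⟩, ⟨b⟩, c, d⟩ => ⟨⟨a.symm⟩, ⟨b.symm⟩, c.symm, d.symm⟩
      trans := fun ⟨⟨a⟩, ⟨b⟩, c, d⟩ ⟨⟨a'⟩, ⟨b'⟩, c', d'⟩ =>
        ⟨⟨a.trans a'⟩, ⟨b.trans b'⟩, c.trans c', d.trans d'⟩ }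

end Fourtuples

/-! Everything is reduced to one symmetric notion, a duality (`DualPairing`) between an (A,
B)-bimodule M and a (B, A)-bimodule N: a balanced pairing M × N → A with finite dual bases. Its
existence can be read in four ways: M is finitely generated projective over A on the left and N is
its left dual (`nonempty_iff_leftDual`); N is finitely generated projective over A on the right and
M is its right dual (`nonempty_iff_rightDual`); M ⊗ - is left adjoint to N ⊗ - on left modules
(`nonempty_iff_adjunction`); - ⊗ N is left adjoint to - ⊗ M on right modules
(`nonempty_iff_adjunction_right`).

Both conditions in (a) say that Λ is dual to X and that X is dual to V ⊗ Λ ⊗ U; each reads one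
duality through the left dual and the other through the right dual. Read as adjunctions, the two
dualities say that (Λ ⊗ -, X ⊗ -) is a Frobenius pair for U ⊗ - and V ⊗ -. For right modules, the
second adjunction is first conjugated by the equivalences into U ⊗ X ⊗ V being dual to Λ, which
gives the Frobenius pair (- ⊗ X, - ⊗ Λ).

For (b), all four functors of a Frobenius datum are left adjoints, so by the Eilenberg–Watts theorem
(`exists_iso_tensorLeft`) they are tensor functors, and a tensor functor determines its bimodule by
evaluation at the regular module. An equivalence P ⊗ - extends to a strict Morita context
(`exists_strict_of_adjunction`), and such a context is determined by P alone (`isomorphic_of_iso`),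
because the second bimodule is the dual of P and P is faithful on the right. Part (c) then follows
from the uniqueness of adjoints: in a fourtuple, X and Λ determine each other. -/

namespace BTensor

/-! ### Universal property, unit laws and associativity of the balanced tensor product. -/

section Lift

variable {B : Type u} [Ring B] {M N : Type u}
  [AddCommGroup M] [Module Bᵐᵒᵖ M] [AddCommGroup N] [Module B N]

/-- The additive map out of `M ⊗_B N` induced by a balanced biadditive map. -/
def lift {P : Type*} [AddCommGroup P] (f : M →+ N →+ P)
    (h : ∀ (m : M) (b : B) (n : N), f (op b • m) n = f m (b • n)) : BTensor B M N →+ P :=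
  QuotientAddGroup.lift (balancingSubgroup B M N)
    (TensorProduct.liftAddHom f fun r m n => by
      rw [map_zsmul, map_zsmul]; rfl) (by
    refine (AddSubgroup.closure_le _).2 ?_
    rintro _ ⟨m, b, n, rfl⟩
    change TensorProduct.liftAddHom f _ _ = 0
    rw [map_sub, TensorProduct.liftAddHom_tmul, TensorProduct.liftAddHom_tmul, h, sub_self])

variable (B M N) in
/-- Pure tensors as a biadditive map. -/
def tmulHom : M →+ N →+ BTensor B M N :=
  AddMonoidHom.mk' (fun m => AddMonoidHom.mk' (fun n => tmul B m n) (tmul_add B m))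
    fun m m' => AddMonoidHom.ext fun n => add_tmul B m m' n

@[simp] theorem tmulHom_apply (m : M) (n : N) : tmulHom B M N m n = tmul B m n := rfl

theorem sum_tmul {ι : Type*} (s : Finset ι) (x : ι → M) (n : N) :
    tmul B (∑ i ∈ s, x i) n = ∑ i ∈ s, tmul B (x i) n :=
  map_sum ((tmulHom B M N).flip n) x s

theorem tmul_sum {ι : Type*} (s : Finset ι) (m : M) (y : ι → N) :
    tmul B m (∑ i ∈ s, y i) = ∑ i ∈ s, tmul B m (y i) :=
  map_sum (tmulHom B M N m) y s

theorem exists_eq_sum (z : BTensor B M N) :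
    ∃ (ι : Type) (_ : Fintype ι) (x : ι → M) (y : ι → N), z = ∑ i, tmul B (x i) (y i) := by
  induction z using BTensor.induction_on with
  | zero => exact ⟨Empty, inferInstance, Empty.elim, Empty.elim, by simp⟩
  | tmul m n => exact ⟨Unit, inferInstance, fun _ => m, fun _ => n, by simp⟩
  | add z z' h h' =>
    obtain ⟨ι, _, x, y, rfl⟩ := h
    obtain ⟨ι', _, x', y', rfl⟩ := h'
    exact ⟨ι ⊕ ι', inferInstance, Sum.elim x x', Sum.elim y y', by simp⟩

/-- The additive map out of `M ⊗_B N` induced by a balanced biadditive function. -/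
def liftFun {P : Type*} [AddCommGroup P] (f : M → N → P)
    (hl : ∀ m m' n, f (m + m') n = f m n + f m' n) (hr : ∀ m n n', f m (n + n') = f m n + f m n')
    (h : ∀ (m : M) (b : B) (n : N), f (op b • m) n = f m (b • n)) : BTensor B M N →+ P :=
  lift (AddMonoidHom.mk' (fun m => AddMonoidHom.mk' (f m) (hr m))
    fun m m' => AddMonoidHom.ext (hl m m')) h

variable (B M) in
/-- `M ⊗_B B ≃ M`. -/
def rid : BTensor B M B ≃+ M :=
  AddMonoidHom.toAddEquiv
    (liftFun (fun m b => op b • m) (fun _ _ _ => smul_add _ _ _)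
      (fun m b b' => by rw [MulOpposite.op_add, add_smul])
      fun m b b' => by rw [smul_eq_mul, MulOpposite.op_mul, mul_smul])
    ((tmulHom B M B).flip 1)
    (hom_ext B fun m n => by
      change tmul B (op n • m) 1 = tmul B m n
      rw [smul_tmul, smul_eq_mul, mul_one])
    (AddMonoidHom.ext fun m => one_smul Bᵐᵒᵖ m)

variable (B N) in
/-- `B ⊗_B N ≃ N`. -/
def lid : BTensor B B N ≃+ N :=
  AddMonoidHom.toAddEquiv
    (liftFun (fun b n => b • n) (fun _ _ _ => add_smul _ _ _) (fun _ _ _ => smul_add _ _ _)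
      fun m b n => mul_smul m b n)
    (tmulHom B B N 1)
    (hom_ext B fun b n => by
      change tmul B 1 (b • n) = tmul B b n
      rw [← smul_tmul, op_smul_eq_mul, one_mul])
    (AddMonoidHom.ext fun n => one_smul B n)

end Lift

section Assoc

variable {B C : Type u} [Ring B] [Ring C] (L : Type u) [AddCommGroup L] [Module Bᵐᵒᵖ L]
  (M : RBimod B C) (N : Type u) [AddCommGroup N] [Module C N]

/-- `m ↦ m ⊗ n` as a left linear map. -/
def tmulRight (n : N) : M →ₗ[B] BTensor C M N where
  toFun m := tmul C m n
  map_add' m m' := add_tmul C m m' n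
  map_smul' _ _ := rfl

/-- `m ↦ l ⊗ m` as a right linear map. -/
def tmulLeft (l : L) : M →ₗ[Cᵐᵒᵖ] BTensor B L M where
  toFun m := tmul B l m
  map_add' m m' := tmul_add B l m m'
  map_smul' _ _ := rfl

/-- The forward associativity map. -/
def assocHom : BTensor C (BTensor B L M) N →+ BTensor B L (BTensor C M N) :=
  liftFun (fun z n => map B LinearMap.id (tmulRight M N n) z) (fun _ _ _ => map_add _ _ _)
    (fun z n n' => DFunLike.congr_fun (hom_ext B (f := map B LinearMap.id (tmulRight M N (n + n')))
      (g := map B LinearMap.id (tmulRight M N n) + map B LinearMap.id (tmulRight M N n'))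
      fun l m => (congrArg (tmul B l) (tmul_add C m n n')).trans (tmul_add B l _ _)) z)
    (fun z c n => DFunLike.congr_fun (hom_ext B
      (f := (map B LinearMap.id (tmulRight M N n)).comp (map B LinearMap.id (M.rightMul (op c))))
      (g := map B LinearMap.id (tmulRight M N (c • n)))
      fun l m => congrArg (tmul B l) (smul_tmul C m c n)) z)

/-- The backward associativity map. -/
def assocInv : BTensor B L (BTensor C M N) →+ BTensor C (BTensor B L M) N :=
  liftFun (fun l z => map C (tmulLeft L M l) LinearMap.id z)
    (fun l l' z => DFunLike.congr_fun (hom_ext C (f := map C (tmulLeft L M (l + l')) LinearMap.id)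
      (g := map C (tmulLeft L M l) LinearMap.id + map C (tmulLeft L M l') LinearMap.id)
      fun m n => (congrArg (fun t => tmul C t n) (add_tmul B l l' m)).trans
        (add_tmul C _ _ n)) z)
    (fun _ _ _ => map_add _ _ _)
    (fun l b z => DFunLike.congr_fun (hom_ext C
      (f := map C (tmulLeft L M (op b • l)) LinearMap.id)
      (g := (map C (tmulLeft L M l) LinearMap.id).comp (map C (M.leftMul b) LinearMap.id))
      fun m n => congrArg (fun t => tmul C t n) (smul_tmul B l b m)) z)

variable {L M N} in
theorem hom_ext_left {P : Type*} [AddCommGroup P] {f g : BTensor C (BTensor B L M) N →+ P}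
    (h : ∀ l m n, f (tmul C (tmul B l m) n) = g (tmul C (tmul B l m) n)) : f = g :=
  hom_ext C fun z n => DFunLike.congr_fun (hom_ext B
    (f := f.comp ((tmulHom C (BTensor B L M) N).flip n))
    (g := g.comp ((tmulHom C (BTensor B L M) N).flip n)) fun l m => h l m n) z

variable {L M N} in
theorem hom_ext_right {P : Type*} [AddCommGroup P] {f g : BTensor B L (BTensor C M N) →+ P}
    (h : ∀ l m n, f (tmul B l (tmul C m n)) = g (tmul B l (tmul C m n))) : f = g :=
  hom_ext B fun l z => DFunLike.congr_fun (hom_ext C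
    (f := f.comp (tmulHom B L (BTensor C M N) l))
    (g := g.comp (tmulHom B L (BTensor C M N) l)) fun m n => h l m n) z

/-- `(L ⊗_B M) ⊗_C N ≃ L ⊗_B (M ⊗_C N)`. -/
def assoc : BTensor C (BTensor B L M) N ≃+ BTensor B L (BTensor C M N) :=
  AddMonoidHom.toAddEquiv (assocHom L M N) (assocInv L M N)
    (hom_ext_left fun _ _ _ => rfl) (hom_ext_right fun _ _ _ => rfl)

end Assoc

end BTensor

/-! ### Tensor functors: composition, identity, and recovery of the bimodule. -/

namespace RBimod

variable {A B C : Type u} [Ring A] [Ring B] [Ring C]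

/-- A bimodule isomorphism from an additive equivalence. -/
def Iso.ofAddEquiv {M N : RBimod A B} (e : M ≃+ N) (h : ∀ (a : A) (m : M), e (a • m) = a • e m)
    (h' : ∀ (b : Bᵐᵒᵖ) (m : M), e (b • m) = b • e m) : Iso M N :=
  { e with map_smul' := h, map_op_smul' := h' }

theorem Iso.map_smul {M N : RBimod A B} (e : Iso M N) (a : A) (m : M) :
    e.toAddEquiv (a • m) = a • e.toAddEquiv m := e.map_smul' a m

theorem Iso.map_op_smul {M N : RBimod A B} (e : Iso M N) (b : Bᵐᵒᵖ) (m : M) :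
    e.toAddEquiv (b • m) = b • e.toAddEquiv m := e.map_op_smul' b m

/-- The morphism out of `M ⊗_B K` given by a balanced map. -/
def tensorLeftDesc (M : RBimod A B) {K : ModuleCat.{u} B} {L : ModuleCat.{u} A}
    (φ : M →+ K →+ L) (h : ∀ (m : M) (b : B) (k : K), φ (op b • m) k = φ m (b • k))
    (h' : ∀ (a : A) (m : M) (k : K), φ (a • m) k = a • φ m k) :
    M.tensorLeftFunctor.obj K ⟶ L :=
  ModuleCat.ofHom (X := BTensor B M K)
    { BTensor.lift φ h with
      map_smul' := fun a z => by
        change BTensor.lift φ h (a • z) = a • BTensor.lift φ h z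
        induction z using BTensor.induction_on with
        | zero => simp
        | tmul m k => exact h' a m k
        | add z z' h h' => rw [smul_add, map_add, map_add, smul_add, h, h'] }

theorem tensorLeft_hom_ext {M : RBimod A B} {K : ModuleCat.{u} B} {L : ModuleCat.{u} A}
    {f g : M.tensorLeftFunctor.obj K ⟶ L}
    (h : ∀ (m : M) (k : K), f.hom (BTensor.tmul B m k : BTensor B M K) =
      g.hom (BTensor.tmul B m k : BTensor B M K)) : f = g := by
  ext z
  exact DFunLike.congr_fun (BTensor.hom_ext B (f := f.hom.toAddMonoidHom)
    (g := g.hom.toAddMonoidHom) h) z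

theorem tensorRight_hom_ext {M : RBimod A B} {K : ModuleCat.{u} Aᵐᵒᵖ} {L : ModuleCat.{u} Bᵐᵒᵖ}
    {f g : M.tensorRightFunctor.obj K ⟶ L}
    (h : ∀ (k : K) (m : M), f.hom (BTensor.tmul A k m : BTensor A K M) =
      g.hom (BTensor.tmul A k m : BTensor A K M)) : f = g := by
  ext z
  exact DFunLike.congr_fun (BTensor.hom_ext A (f := f.hom.toAddMonoidHom)
    (g := g.hom.toAddMonoidHom) h) z

theorem tensorLeft_hom_ext₂ {M : RBimod A B} {N : RBimod B C} {K : ModuleCat.{u} C}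
    {L : ModuleCat.{u} A}
    {f g : M.tensorLeftFunctor.obj (N.tensorLeftFunctor.obj K) ⟶ L}
    (h : ∀ (m : M) (n : N) (k : K),
      f.hom (BTensor.tmul B m (BTensor.tmul C n k) : BTensor B M (BTensor C N K)) =
      g.hom (BTensor.tmul B m (BTensor.tmul C n k) : BTensor B M (BTensor C N K))) : f = g := by
  refine tensorLeft_hom_ext fun m z => ?_
  exact DFunLike.congr_fun (BTensor.hom_ext C
    (f := f.hom.toAddMonoidHom.comp (BTensor.tmulHom B M (BTensor C N K) m))
    (g := g.hom.toAddMonoidHom.comp (BTensor.tmulHom B M (BTensor C N K) m)) (h m)) z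

/-- The associativity isomorphism as a left linear equivalence. -/
def tensorLeftAssoc (M : RBimod A B) (N : RBimod B C) (K : ModuleCat.{u} C) :
    (M.tensor N).tensorLeftFunctor.obj K ≃ₗ[A]
      M.tensorLeftFunctor.obj (N.tensorLeftFunctor.obj K) :=
  { BTensor.assoc M N K with
    map_smul' := fun a z => DFunLike.congr_fun (BTensor.hom_ext_left
      (f := (BTensor.assoc M N K).toAddMonoidHom.comp
        (BTensor.map C ((M.tensor N).leftMul a) LinearMap.id))
      (g := (BTensor.map B (M.leftMul a) LinearMap.id).comp
        (BTensor.assoc M N K).toAddMonoidHom)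
      fun _ _ _ => rfl) z }

/-- The associativity isomorphism as a right linear equivalence. -/
def tensorRightAssoc (M : RBimod A B) (N : RBimod B C) (K : ModuleCat.{u} Aᵐᵒᵖ) :
    N.tensorRightFunctor.obj (M.tensorRightFunctor.obj K) ≃ₗ[Cᵐᵒᵖ]
      (M.tensor N).tensorRightFunctor.obj K :=
  { BTensor.assoc K M N with
    map_smul' := fun c z => DFunLike.congr_fun (BTensor.hom_ext_left
      (f := (BTensor.assoc K M N).toAddMonoidHom.comp
        (BTensor.map B LinearMap.id (N.rightMul c)))
      (g := (BTensor.map A LinearMap.id ((M.tensor N).rightMul c)).comp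
        (BTensor.assoc K M N).toAddMonoidHom)
      fun _ _ _ => rfl) z }

/-- Tensoring with `M ⊗_B N` is tensoring with `N` and then with `M`. -/
def tensorLeftComp (M : RBimod A B) (N : RBimod B C) :
    N.tensorLeftFunctor ⋙ M.tensorLeftFunctor ≅ (M.tensor N).tensorLeftFunctor :=
  (NatIso.ofComponents
    (F := (M.tensor N).tensorLeftFunctor) (G := N.tensorLeftFunctor ⋙ M.tensorLeftFunctor)
    (fun K => (tensorLeftAssoc M N K).toModuleIso)
    fun {K K'} f => tensorLeft_hom_ext fun w k => DFunLike.congr_fun (BTensor.hom_ext_left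
        (f := (BTensor.assoc M N K').toAddMonoidHom.comp
          (BTensor.map C (LinearMap.id : M.tensor N →ₗ[Cᵐᵒᵖ] M.tensor N) f.hom))
        (g := (BTensor.map B LinearMap.id (N.tensorLeftFunctor.map f).hom).comp
          (BTensor.assoc M N K).toAddMonoidHom) fun _ _ _ => rfl) (BTensor.tmul C w k)).symm

/-- Tensoring on the right with `M ⊗_B N` is tensoring with `M` and then with `N`. -/
def tensorRightComp (M : RBimod A B) (N : RBimod B C) :
    M.tensorRightFunctor ⋙ N.tensorRightFunctor ≅ (M.tensor N).tensorRightFunctor :=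
  NatIso.ofComponents
    (F := M.tensorRightFunctor ⋙ N.tensorRightFunctor) (G := (M.tensor N).tensorRightFunctor)
    (fun K => (tensorRightAssoc M N K).toModuleIso)
    fun {K K'} f => tensorRight_hom_ext (M := N) (K := M.tensorRightFunctor.obj K) fun w k =>
      DFunLike.congr_fun (BTensor.hom_ext_left
        (f := (BTensor.assoc K' M N).toAddMonoidHom.comp
          (BTensor.map B (M.tensorRightFunctor.map f).hom LinearMap.id))
        (g := (BTensor.map A f.hom (LinearMap.id : M.tensor N →ₗ[A] M.tensor N)).comp
          (BTensor.assoc K M N).toAddMonoidHom) fun _ _ _ => rfl) (BTensor.tmul B w k)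

variable (A) in
/-- Tensoring with the regular bimodule is the identity functor. -/
def tensorLeftSelf : (self A).tensorLeftFunctor ≅ 𝟭 (ModuleCat.{u} A) :=
  NatIso.ofComponents (fun K => LinearEquiv.toModuleIso
    (X₁ := BTensor A (self A) K) (X₂ := K)
    { BTensor.lid A K with
      map_smul' := fun a z => DFunLike.congr_fun (BTensor.hom_ext A
        (f := (BTensor.lid A K).toAddMonoidHom.comp
          (BTensor.map A ((self A).leftMul a) LinearMap.id))
        (g := (DistribSMul.toAddMonoidHom K a).comp (BTensor.lid A K).toAddMonoidHom)
        fun b k => mul_smul a b k) z })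
    fun f => tensorLeft_hom_ext fun b k => (f.hom.map_smul b k).symm

variable (A) in
/-- Tensoring on the right with the regular bimodule is the identity functor. -/
def tensorRightSelf : (self A).tensorRightFunctor ≅ 𝟭 (ModuleCat.{u} Aᵐᵒᵖ) :=
  NatIso.ofComponents (fun K => LinearEquiv.toModuleIso
    (X₁ := BTensor A K (self A)) (X₂ := K)
    { BTensor.rid A K with
      map_smul' := fun a z => DFunLike.congr_fun (BTensor.hom_ext A
        (f := (BTensor.rid A K).toAddMonoidHom.comp
          (BTensor.map A LinearMap.id ((self A).rightMul a)))
        (g := (DistribSMul.toAddMonoidHom K a).comp (BTensor.rid A K).toAddMonoidHom)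
        fun k b => mul_smul a (op b) k) z })
    fun f => tensorRight_hom_ext fun k b => (f.hom.map_smul (op b) k).symm

/-- Isomorphic bimodules give isomorphic tensor functors. -/
def tensorLeftCongr {M N : RBimod A B} (e : RBimod.Iso M N) :
    M.tensorLeftFunctor ≅ N.tensorLeftFunctor :=
  NatIso.ofComponents (fun K =>
    { hom := M.tensorLeftDesc (K := K) (L := N.tensorLeftFunctor.obj K)
        ((BTensor.tmulHom B N K).comp e.toAddEquiv.toAddMonoidHom)
        (fun m b k => (congrArg (fun t => BTensor.tmul B t k) (e.map_op_smul (op b) m)).trans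
          (BTensor.smul_tmul B (e.toAddEquiv m) b k))
        (fun a m k => (congrArg (fun t => BTensor.tmul B t k) (e.map_smul a m)))
      inv := N.tensorLeftDesc (K := K) (L := M.tensorLeftFunctor.obj K)
        ((BTensor.tmulHom B M K).comp e.symm.toAddEquiv.toAddMonoidHom)
        (fun m b k => (congrArg (fun t => BTensor.tmul B t k) (e.symm.map_op_smul (op b) m)).trans
          (BTensor.smul_tmul B (e.symm.toAddEquiv m) b k))
        (fun a m k => (congrArg (fun t => BTensor.tmul B t k) (e.symm.map_smul a m)))
      hom_inv_id := tensorLeft_hom_ext fun m k =>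
        congrArg (fun t => BTensor.tmul B t k) (e.toAddEquiv.symm_apply_apply m)
      inv_hom_id := tensorLeft_hom_ext fun m k =>
        congrArg (fun t => BTensor.tmul B t k) (e.toAddEquiv.apply_symm_apply m) })
    fun _ => tensorLeft_hom_ext fun _ _ => rfl

/-- A natural isomorphism of tensor functors comes from an isomorphism of bimodules. -/
def isoOfTensorLeftIso {M N : RBimod A B} (e : M.tensorLeftFunctor ≅ N.tensorLeftFunctor) :
    RBimod.Iso M N :=
  let E : BTensor B M B ≃ₗ[A] BTensor B N B := (e.app (ModuleCat.of B B)).toLinearEquiv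
  Iso.ofAddEquiv (((BTensor.rid B M).symm.trans E.toAddEquiv).trans (BTensor.rid B N))
    (fun a m => by
      have h (z : BTensor B N B) : BTensor.rid B N (a • z) = a • BTensor.rid B N z := by
        induction z using BTensor.induction_on with
        | zero => simp
        | tmul n b => exact (smul_comm a (op b) n).symm
        | add z z' h h' => rw [smul_add, map_add, map_add, smul_add, h, h']
      exact (congrArg (BTensor.rid B N) (E.map_smul a (BTensor.tmul B m 1))).trans (h _))
    (fun b m => by
      obtain ⟨b, rfl⟩ := op_surjective b
      -- Right multiplication by b is an endomorphism of the left module B; naturality along it is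
      -- right linearity of the induced map.
      let r : ModuleCat.of B B ⟶ ModuleCat.of B B :=
        ModuleCat.ofHom (LinearMap.toSpanSingleton B B b)
      have h (z : BTensor B N B) : BTensor.rid B N (BTensor.map B LinearMap.id r.hom z) =
          op b • BTensor.rid B N z := by
        induction z using BTensor.induction_on with
        | zero => simp
        | tmul n b' =>
          change op (b' * b) • n = op b • op b' • n
          rw [op_mul, mul_smul]
        | add z z' h h' => rw [map_add, map_add, map_add, smul_add, h, h']
      have h' := congrArg (fun f => f.hom (BTensor.tmul B m (1 : B) : BTensor B M B))
        (e.hom.naturality r)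
      refine Eq.trans ?_ ((congrArg (BTensor.rid B N) h').trans (h _))
      refine congrArg (fun t => BTensor.rid B N (E t)) ?_
      change BTensor.tmul B (op b • m) 1 = BTensor.tmul B m ((1 : B) * b)
      rw [BTensor.smul_tmul, smul_eq_mul, mul_one, one_mul])

/-- This lets isomorphisms of bimodules be handled as isomorphisms of functors, where composition
and conjugation by equivalences are formal. -/
theorem nonempty_tensorLeft_iso_iff {M N : RBimod A B} :
    Nonempty (M.tensorLeftFunctor ≅ N.tensorLeftFunctor) ↔ Nonempty (RBimod.Iso M N) :=
  ⟨fun ⟨e⟩ => ⟨isoOfTensorLeftIso e⟩, fun ⟨e⟩ => ⟨tensorLeftCongr e⟩⟩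

end RBimod

/-! ### Dualities of bimodules with finite dual bases. -/

section

variable {A B : Type u} [Ring A] [Ring B]

/-- A duality between an `(A, B)`-bimodule `M` and a `(B, A)`-bimodule `N`: a balanced bimodule
pairing `M × N → A` together with finite dual bases. -/
structure DualPairing (M : RBimod A B) (N : RBimod B A) where
  ev : M →+ N →+ A
  smul_ev : ∀ (a : A) (m : M) (n : N), ev (a • m) n = a * ev m n
  ev_smul : ∀ (m : M) (n : N) (a : A), ev m (op a • n) = ev m n * a
  balanced : ∀ (m : M) (b : B) (n : N), ev (op b • m) n = ev m (b • n)
  ι : Type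
  [fintype : Fintype ι]
  x : ι → M
  y : ι → N
  sum_left : ∀ m : M, ∑ i, ev m (y i) • x i = m
  sum_right : ∀ n : N, ∑ i, op (ev (x i) n) • y i = n

namespace DualPairing

attribute [instance] fintype

variable {M : RBimod A B} {N : RBimod B A}

/-- The coevaluation element Σ yᵢ ⊗ xᵢ commutes with B: expand b yᵢ in the dual basis, move the
coefficient ev(xⱼ, b yᵢ) = ev(xⱼ b, yᵢ) across the tensor sign, and sum over i. The map h allows
further factors to the right of xᵢ. -/
theorem coev_central (D : DualPairing M N) {T : Type u} [AddCommGroup T] [Module A T]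
    (h : M →ₗ[A] T) (b : B) :
    ∑ i, BTensor.tmul A (b • D.y i) (h (D.x i)) =
      ∑ i, BTensor.tmul A (D.y i) (h (op b • D.x i)) := by
  have h₁ (i : D.ι) : BTensor.tmul A (b • D.y i) (h (D.x i)) =
      ∑ j, BTensor.tmul A (D.y j) (h (D.ev (op b • D.x j) (D.y i) • D.x i)) := by
    conv_lhs => rw [← D.sum_right (b • D.y i), BTensor.sum_tmul]
    refine Finset.sum_congr rfl fun j _ => ?_
    rw [BTensor.smul_tmul, ← h.map_smul, D.balanced]
  simp_rw [h₁]
  rw [Finset.sum_comm]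
  refine Finset.sum_congr rfl fun j _ => ?_
  rw [← BTensor.tmul_sum, ← map_sum, D.sum_left]

/-- The pairing `n ⊗ l ↦ ev(m, n) l`. -/
def evSMul (D : DualPairing M N) (L : Type u) [AddCommGroup L] [Module A L] (m : M) :
    BTensor A N L →+ L :=
  BTensor.liftFun (fun n l => D.ev m n • l) (fun n n' l => by rw [map_add, add_smul])
    (fun n l l' => smul_add _ _ _) fun n a l => by rw [D.ev_smul, mul_smul]

/-- The counit of the adjunction of a duality. -/
def counit (D : DualPairing M N) (L : ModuleCat.{u} A) :
    M.tensorLeftFunctor.obj (N.tensorLeftFunctor.obj L) ⟶ L :=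
  M.tensorLeftDesc (K := N.tensorLeftFunctor.obj L)
    (AddMonoidHom.mk' (D.evSMul L) fun m m' => BTensor.hom_ext A fun n l => by
      change D.ev (m + m') n • l = D.ev m n • l + D.ev m' n • l
      rw [map_add, AddMonoidHom.add_apply, add_smul])
    (fun m b k => DFunLike.congr_fun (BTensor.hom_ext A (f := D.evSMul L (op b • m))
      (g := (D.evSMul L m).comp (BTensor.map A (N.leftMul b) LinearMap.id))
      fun n l => congrArg (fun t : A => t • l) (D.balanced m b n)) k)
    (fun a m k => DFunLike.congr_fun (BTensor.hom_ext A (f := D.evSMul L (a • m))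
      (g := (DistribSMul.toAddMonoidHom L a).comp (D.evSMul L m))
      fun n l => (congrArg (fun t : A => t • l) (D.smul_ev a m n)).trans (mul_smul _ _ l)) k)

/-- The unit of the adjunction of a duality. -/
def unit (D : DualPairing M N) (K : ModuleCat.{u} B) :
    K ⟶ N.tensorLeftFunctor.obj (M.tensorLeftFunctor.obj K) :=
  ModuleCat.ofHom (Y := BTensor A N (BTensor B M K))
    { toFun := fun k => ∑ i, BTensor.tmul A (D.y i) (BTensor.tmul B (D.x i) k)
      map_add' := fun k k' => by
        simp only [BTensor.tmul_add, Finset.sum_add_distrib]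
      map_smul' := fun b k => by
        -- Linearity of the unit is exactly the centrality of the coevaluation element.
        have h := D.coev_central (BTensor.tmulRight M K k) b
        simp only [← BTensor.smul_tmul]
        exact h.symm.trans (map_sum (BTensor.map A (N.leftMul b)
          (LinearMap.id : BTensor B M K →ₗ[A] BTensor B M K))
          (fun i => BTensor.tmul A (D.y i) (BTensor.tmul B (D.x i) k)) Finset.univ).symm }

theorem unit_apply (D : DualPairing M N) (K : ModuleCat.{u} B) (k : K) :
    (D.unit K).hom k =
      (∑ i, BTensor.tmul A (D.y i) (BTensor.tmul B (D.x i) k) : BTensor A N (BTensor B M K)) :=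
  rfl

/-- A duality yields an adjunction between the tensor functors. -/
def adjunction (D : DualPairing M N) : M.tensorLeftFunctor ⊣ N.tensorLeftFunctor :=
  Adjunction.mkOfUnitCounit
    { unit :=
        { app := D.unit
          naturality := fun K K' f => by
            ext k
            exact (map_sum (N.tensorLeftFunctor.map (M.tensorLeftFunctor.map f)).hom
              (fun i => (BTensor.tmul A (D.y i) (BTensor.tmul B (D.x i) k) :
                BTensor A N (BTensor B M K))) Finset.univ).symm }
      counit :=
        { app := D.counit
          naturality := fun L L' f => RBimod.tensorLeft_hom_ext₂ fun m n l =>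
            (f.hom.map_smul (D.ev m n) l).symm }
      left_triangle := by
        ext K : 2
        refine RBimod.tensorLeft_hom_ext fun m k => ?_
        -- On m ⊗ k the triangle identity becomes Σ ev(m, yᵢ) xᵢ ⊗ k = m ⊗ k, the dual basis
        -- identity for M; the other triangle is the one for N.
        let t (i : D.ι) : BTensor A N (BTensor B M K) :=
          BTensor.tmul A (D.y i) (BTensor.tmul B (D.x i) k)
        refine (congrArg (D.counit (M.tensorLeftFunctor.obj K)).hom
          (BTensor.tmul_sum Finset.univ m t)).trans ?_
        refine (map_sum (D.counit (M.tensorLeftFunctor.obj K)).hom _ _).trans ?_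
        refine Eq.trans ?_ (congrArg (fun m => BTensor.tmul B m k) (D.sum_left m))
        exact (BTensor.sum_tmul _ _ _).symm
      right_triangle := by
        ext L : 2
        refine RBimod.tensorLeft_hom_ext fun n l => ?_
        let t (i : D.ι) : BTensor A N (BTensor B M (BTensor A N L)) :=
          BTensor.tmul A (D.y i) (BTensor.tmul B (D.x i) (BTensor.tmul A n l))
        refine (map_sum (N.tensorLeftFunctor.map (D.counit L)).hom t _).trans ?_
        refine Eq.trans ?_ (congrArg (fun n => BTensor.tmul A n l) (D.sum_right n))
        refine Eq.trans ?_ (BTensor.sum_tmul _ _ _).symm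
        exact Finset.sum_congr rfl fun i _ =>
          (BTensor.smul_tmul A (D.y i) (D.ev (D.x i) n) l).symm }

/-- The map `n ↦ ev(-, n)`. -/
def evLeft (D : DualPairing M N) : N →+ (M →ₗ[A] A) :=
  AddMonoidHom.mk' (fun n =>
    { toFun := fun m => D.ev m n
      map_add' := fun m m' => by rw [map_add]; rfl
      map_smul' := fun a m => D.smul_ev a m n }) fun n n' => LinearMap.ext fun m =>
        map_add (D.ev m) n n'

/-- The map `m ↦ ev(m, -)`. -/
def evRight (D : DualPairing M N) : M →+ (N →ₗ[Aᵐᵒᵖ] A) :=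
  AddMonoidHom.mk' (fun m =>
    { toFun := fun n => D.ev m n
      map_add' := map_add _
      map_smul' := fun a n => D.ev_smul m n a.unop }) fun m m' => LinearMap.ext fun n =>
        DFunLike.congr_fun (map_add D.ev m m') n

/-- The isomorphism of the second bimodule of a duality with the left dual of the first. -/
noncomputable def isoLeftDual (D : DualPairing M N) : RBimod.Iso N M.leftDual :=
  RBimod.Iso.ofAddEquiv (N := M.leftDual)
    (AddEquiv.ofBijective D.evLeft
      ⟨fun n n' h => by
        rw [← D.sum_right n, ← D.sum_right n']
        exact Finset.sum_congr rfl fun i _ => congrArg (fun t : A => op t • D.y i)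
          (LinearMap.congr_fun h (D.x i)),
      fun (φ : M →ₗ[A] A) => ⟨∑ i, op (φ (D.x i)) • D.y i, LinearMap.ext fun m => by
        change D.ev m _ = φ m
        conv_rhs => rw [← D.sum_left m]
        simp only [map_sum, D.ev_smul, map_smul, smul_eq_mul]⟩⟩)
    (fun b n => LinearMap.ext fun m => (D.balanced m b n).symm)
    (fun a n => LinearMap.ext fun m => D.ev_smul m n a.unop)

/-- The isomorphism of the first bimodule of a duality with the right dual of the second. -/
noncomputable def isoRightDual (D : DualPairing M N) : RBimod.Iso M N.rightDual :=
  RBimod.Iso.ofAddEquiv (N := N.rightDual)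
    (AddEquiv.ofBijective D.evRight
      ⟨fun m m' h => by
        rw [← D.sum_left m, ← D.sum_left m']
        exact Finset.sum_congr rfl fun i _ => congrArg (fun t : A => t • D.x i)
          (LinearMap.congr_fun h (D.y i)),
      fun (φ : N →ₗ[Aᵐᵒᵖ] A) => ⟨∑ i, φ (D.y i) • D.x i, LinearMap.ext fun n => by
        change D.ev _ n = φ n
        conv_rhs => rw [← D.sum_right n]
        simp only [map_sum, AddMonoidHom.finsetSum_apply, D.smul_ev, map_smul, op_smul_eq_mul]⟩⟩)
    (fun a m => LinearMap.ext fun n => D.smul_ev a m n)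
    (fun b m => LinearMap.ext fun n => D.balanced m b.unop n)

/-- The coordinates m ↦ ev(m, yᵢ), followed by the linear combination of the xᵢ, exhibit M as a
retract of a finite free module. -/
theorem fg_projective_left (D : DualPairing M N) :
    Module.Finite A M ∧ Module.Projective A M := by
  let i : M →ₗ[A] (D.ι → A) :=
    { toFun := fun m j => D.ev m (D.y j)
      map_add' := fun m m' => by ext j; simp
      map_smul' := fun a m => by ext j; exact D.smul_ev a m _ }
  have h : Fintype.linearCombination A D.x ∘ₗ i = LinearMap.id :=
    LinearMap.ext fun m => D.sum_left m
  exact ⟨Module.Finite.of_surjective (Fintype.linearCombination A D.x) fun m =>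
    ⟨i m, LinearMap.congr_fun h m⟩, Module.Projective.of_split i _ h⟩

theorem fg_projective_right (D : DualPairing M N) :
    Module.Finite Aᵐᵒᵖ N ∧ Module.Projective Aᵐᵒᵖ N := by
  let i : N →ₗ[Aᵐᵒᵖ] (D.ι → Aᵐᵒᵖ) :=
    { toFun := fun n j => op (D.ev (D.x j) n)
      map_add' := fun m m' => by ext j; simp
      map_smul' := fun a n => by ext j; exact congrArg op (D.ev_smul _ n a.unop) }
  have h : Fintype.linearCombination Aᵐᵒᵖ D.y ∘ₗ i = LinearMap.id :=
    LinearMap.ext fun n => D.sum_right n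
  exact ⟨Module.Finite.of_surjective (Fintype.linearCombination Aᵐᵒᵖ D.y) fun m =>
    ⟨i m, LinearMap.congr_fun h m⟩, Module.Projective.of_split i _ h⟩

/-- The pairing is evaluation of functionals. A retraction of some Aᵏ onto M supplies the dual
bases: xᵢ is the image of the i-th basis vector, and yᵢ corresponds to the i-th coordinate
functional on M. -/
theorem nonempty_of_isoLeftDual [Module.Finite A M] [Module.Projective A M]
    (e : RBimod.Iso N M.leftDual) : Nonempty (DualPairing M N) := by
  obtain ⟨k, f, g, -, -, hfg⟩ := Module.Finite.exists_comp_eq_id_of_projective A M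
  let E : N ≃+ (M →ₗ[A] A) := e.toAddEquiv
  have hs (m : M) : ∑ i, g m i • f (Pi.single i 1) = m := by
    conv_rhs => rw [← LinearMap.id_apply (R := A) m, ← hfg, LinearMap.comp_apply,
      pi_eq_sum_univ' (g m), map_sum]
    refine Finset.sum_congr rfl fun i _ => ?_
    rw [map_smul]
  have hE (n : N) (a : A) (m : M) : E (op a • n) m = E n m * a :=
    LinearMap.congr_fun (e.map_op_smul (op a) n) m
  refine ⟨
    { ev := AddMonoidHom.mk' (fun m => AddMonoidHom.mk' (fun n => E n m)
        fun n n' => by rw [map_add]; rfl) fun m m' => AddMonoidHom.ext fun n => map_add (E n) m m'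
      smul_ev := fun a m n => (E n).map_smul a m
      ev_smul := fun m n a => hE n a m
      balanced := fun m b n => (LinearMap.congr_fun (e.map_smul b n) m).symm
      ι := Fin k
      x := fun i => f (Pi.single i 1)
      y := fun i => E.symm (LinearMap.proj i ∘ₗ g)
      sum_left := fun m => ?_
      sum_right := fun n => E.injective (LinearMap.ext fun m => ?_) }⟩
  · conv_rhs => rw [← hs m]
    refine Finset.sum_congr rfl fun i _ => ?_
    change (E (E.symm _) m) • _ = _
    rw [E.apply_symm_apply]; rfl
  · change E (∑ i, op (E n (f (Pi.single i 1))) • E.symm (LinearMap.proj i ∘ₗ g)) m = E n m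
    conv_rhs => rw [← hs m]
    rw [map_sum, map_sum, LinearMap.sum_apply]
    refine Finset.sum_congr rfl fun i _ => ?_
    rw [hE, E.apply_symm_apply, map_smul]; rfl

/-- The mirror image of `nonempty_of_isoLeftDual`: now the retraction lives on N, and the xᵢ come
from the coordinate functionals. -/
theorem nonempty_of_isoRightDual [Module.Finite Aᵐᵒᵖ N] [Module.Projective Aᵐᵒᵖ N]
    (e : RBimod.Iso M N.rightDual) : Nonempty (DualPairing M N) := by
  obtain ⟨k, f, g, -, -, hfg⟩ := Module.Finite.exists_comp_eq_id_of_projective Aᵐᵒᵖ N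
  let E : M ≃+ (N →ₗ[Aᵐᵒᵖ] A) := e.toAddEquiv
  have hs (n : N) : ∑ i, g n i • f (Pi.single i 1) = n := by
    conv_rhs => rw [← LinearMap.id_apply (R := Aᵐᵒᵖ) n, ← hfg, LinearMap.comp_apply,
      pi_eq_sum_univ' (g n), map_sum]
    refine Finset.sum_congr rfl fun i _ => ?_
    rw [map_smul]
  let φ (i : Fin k) : N →ₗ[Aᵐᵒᵖ] A :=
    { toFun := fun n => (g n i).unop
      map_add' := fun n n' => by simp
      map_smul' := fun a n => by simp }
  have hE (m : M) (a : A) (n : N) : E (a • m) n = a * E m n :=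
    LinearMap.congr_fun (e.map_smul a m) n
  refine ⟨
    { ev := AddMonoidHom.mk' (fun m => AddMonoidHom.mk' (fun n => E m n)
        fun n n' => map_add (E m) n n') fun m m' => AddMonoidHom.ext fun n => by
          simp
      smul_ev := fun a m n => hE m a n
      ev_smul := fun m n a => (E m).map_smul (op a) n
      balanced := fun m b n => (LinearMap.congr_fun (e.map_op_smul (op b) m) n)
      ι := Fin k
      x := fun i => E.symm (φ i)
      y := fun i => f (Pi.single i 1)
      sum_left := fun m => E.injective (LinearMap.ext fun n => ?_)
      sum_right := fun n => ?_ }⟩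
  · change E (∑ i, E m (f (Pi.single i 1)) • E.symm (φ i)) n = E m n
    conv_rhs => rw [← hs n]
    rw [map_sum, map_sum, LinearMap.sum_apply]
    refine Finset.sum_congr rfl fun i _ => ?_
    rw [hE, E.apply_symm_apply, map_smul]; rfl
  · conv_rhs => rw [← hs n]
    refine Finset.sum_congr rfl fun i _ => ?_
    change op (E (E.symm _) n) • _ = _
    rw [E.apply_symm_apply]; rfl

end DualPairing

end

/-! ### From adjunctions of tensor functors back to dualities. -/

section

variable {A B : Type u} [Ring A] [Ring B]

namespace DualPairing

variable {M : RBimod A B} {N : RBimod B A}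

/-- The pairing defined by the counit of an adjunction of tensor functors. -/
def adjEv (adj : M.tensorLeftFunctor ⊣ N.tensorLeftFunctor) : M →+ N →+ A :=
  AddMonoidHom.mk' (fun m =>
    (adj.counit.app (ModuleCat.of A A)).hom.toAddMonoidHom.comp
      ((BTensor.tmulHom B M (BTensor A N A) m).comp ((BTensor.tmulHom A N A).flip 1)))
    fun m m' => AddMonoidHom.ext fun _ =>
      (congrArg (adj.counit.app (ModuleCat.of A A)).hom (BTensor.add_tmul B m m' _)).trans
        (map_add (adj.counit.app (ModuleCat.of A A)).hom _ _)

/-- Naturality along the map A → L, 1 ↦ l, shows that the counit is determined by its component at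
A. -/
theorem adj_counit_tmul (adj : M.tensorLeftFunctor ⊣ N.tensorLeftFunctor) (L : ModuleCat.{u} A)
    (m : M) (n : N) (l : L) :
    (adj.counit.app L).hom (BTensor.tmul B m (BTensor.tmul A n l) :
      BTensor B M (BTensor A N L)) = adjEv adj m n • l := by
  have h := congrArg (fun f => f.hom (BTensor.tmul B m (BTensor.tmul A n (1 : A)) :
      BTensor B M (BTensor A N A)))
    (adj.counit.naturality (ModuleCat.ofHom (X := A) (LinearMap.toSpanSingleton A L l)))
  refine Eq.trans ?_ h
  refine congrArg (fun l => (adj.counit.app L).hom (BTensor.tmul B m (BTensor.tmul A n l) :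
    BTensor B M (BTensor A N L))) (one_smul A l).symm

/-- By naturality along B → K, 1 ↦ k, the unit is determined by the single element η(1) of its
component at B. -/
theorem adj_unit_apply (adj : M.tensorLeftFunctor ⊣ N.tensorLeftFunctor) {ι : Type} [Fintype ι]
    {y : ι → N} {x : ι → M}
    (hxy : (adj.unit.app (ModuleCat.of B B)).hom (1 : B) =
      (∑ i, BTensor.tmul A (y i) (BTensor.tmul B (x i) (1 : B)) : BTensor A N (BTensor B M B)))
    (K : ModuleCat.{u} B) (k : K) :
    (adj.unit.app K).hom k =
      (∑ i, BTensor.tmul A (y i) (BTensor.tmul B (x i) k) : BTensor A N (BTensor B M K)) := by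
  let f : ModuleCat.of B B ⟶ K := ModuleCat.ofHom (LinearMap.toSpanSingleton B K k)
  have h := congrArg (fun f => f.hom (1 : B)) (adj.unit.naturality f)
  have h₁ : (adj.unit.app K).hom ((1 : B) • k) = (N.tensorLeftFunctor.map
    (M.tensorLeftFunctor.map f)).hom ((adj.unit.app (ModuleCat.of B B)).hom (1 : B)) := h
  rw [one_smul, hxy] at h₁
  refine h₁.trans ?_
  refine (map_sum (N.tensorLeftFunctor.map (M.tensorLeftFunctor.map f)).hom
    (fun i => (BTensor.tmul A (y i) (BTensor.tmul B (x i) (1 : B)) : BTensor A N (BTensor B M B)))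
    Finset.univ).trans ?_
  exact Finset.sum_congr rfl fun i _ =>
    congrArg (fun t => BTensor.tmul A (y i) (BTensor.tmul B (x i) t)) (one_smul B k)

theorem exists_eq_sum_one (z : BTensor A N (BTensor B M B)) :
    ∃ (ι : Type) (_ : Fintype ι) (y : ι → N) (x : ι → M),
      z = ∑ i, BTensor.tmul A (y i) (BTensor.tmul B (x i) (1 : B)) := by
  obtain ⟨ι, i, y, w, h⟩ := BTensor.exists_eq_sum z
  refine ⟨ι, i, y, fun i => BTensor.rid B M (w i), h.trans (Finset.sum_congr rfl fun i _ => ?_)⟩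
  exact congrArg (BTensor.tmul A (y i)) ((BTensor.rid B M).symm_apply_apply (w i)).symm

/-- An adjunction of tensor functors comes from a duality. -/
theorem exists_of_adjunction (adj : M.tensorLeftFunctor ⊣ N.tensorLeftFunctor) :
    ∃ D : DualPairing M N, D.ev = adjEv adj ∧
      (adj.unit.app (ModuleCat.of B B)).hom (1 : B) =
        (∑ i, BTensor.tmul A (D.y i) (BTensor.tmul B (D.x i) (1 : B)) :
          BTensor A N (BTensor B M B)) := by
  -- The dual bases are read off from η(1). The triangle identity at B then gives the expansion in
  -- M, and the one at A gives the expansion in N.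
  obtain ⟨ι, _, y, x, hxy⟩ := exists_eq_sum_one ((adj.unit.app (ModuleCat.of B B)).hom (1 : B))
  refine ⟨
    { ev := adjEv adj
      smul_ev := fun a m n => (adj.counit.app (ModuleCat.of A A)).hom.map_smul a
        (BTensor.tmul B m (BTensor.tmul A n (1 : A)) : BTensor B M (BTensor A N A))
      ev_smul := fun m n a => by
        refine Eq.trans ?_ (adj_counit_tmul adj (ModuleCat.of A A) m n a)
        refine congrArg (fun t => (adj.counit.app (ModuleCat.of A A)).hom
          (BTensor.tmul B m t : BTensor B M (BTensor A N A))) ?_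
        exact (BTensor.smul_tmul A n a (1 : A)).trans
          (congrArg (BTensor.tmul A n) (mul_one a))
      balanced := fun m b n => congrArg (adj.counit.app (ModuleCat.of A A)).hom
        (BTensor.smul_tmul B m b (BTensor.tmul A n (1 : A)))
      ι := ι
      x := x
      y := y
      sum_left := fun m => ?_
      sum_right := fun n => ?_ }, rfl, hxy⟩
  · let t (i : ι) : BTensor A N (BTensor B M B) :=
      BTensor.tmul A (y i) (BTensor.tmul B (x i) (1 : B))
    have h := congrArg (fun f => f.hom (BTensor.tmul B m (1 : B) : BTensor B M B))
      (adj.left_triangle_components (ModuleCat.of B B))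
    have h₁ : (adj.counit.app (M.tensorLeftFunctor.obj (ModuleCat.of B B))).hom
        (BTensor.tmul B m ((adj.unit.app (ModuleCat.of B B)).hom (1 : B)) :
          BTensor B M (BTensor A N (BTensor B M B))) =
        (BTensor.tmul B m (1 : B) : BTensor B M B) := h
    rw [hxy] at h₁
    have h₂ := (congrArg (adj.counit.app (M.tensorLeftFunctor.obj (ModuleCat.of B B))).hom
      (BTensor.tmul_sum (B := B) Finset.univ m t)).symm.trans h₁
    have h₃ := (map_sum (adj.counit.app (M.tensorLeftFunctor.obj (ModuleCat.of B B))).hom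
      _ _).symm.trans h₂
    have h₄ : ∑ i, BTensor.tmul B (adjEv adj m (y i) • x i) (1 : B) = BTensor.tmul B m (1 : B) := by
      refine Eq.trans (Finset.sum_congr rfl fun i _ => ?_) h₃
      exact (adj_counit_tmul adj (M.tensorLeftFunctor.obj (ModuleCat.of B B)) m (y i)
        (BTensor.tmul B (x i) (1 : B) : BTensor B M B)).symm
    rw [← BTensor.sum_tmul] at h₄
    exact (BTensor.rid B M).symm.injective h₄
  · let t (i : ι) : BTensor A N (BTensor B M (BTensor A N A)) :=
      BTensor.tmul A (y i) (BTensor.tmul B (x i) (BTensor.tmul A n (1 : A)))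
    have h := congrArg (fun f => f.hom (BTensor.tmul A n (1 : A) : BTensor A N A))
      (adj.right_triangle_components (ModuleCat.of A A))
    have h₁ : (N.tensorLeftFunctor.map (adj.counit.app (ModuleCat.of A A))).hom
        ((adj.unit.app (N.tensorLeftFunctor.obj (ModuleCat.of A A))).hom
          (BTensor.tmul A n (1 : A) : BTensor A N A)) = (BTensor.tmul A n (1 : A)) := h
    have h₂ := adj_unit_apply adj hxy (N.tensorLeftFunctor.obj (ModuleCat.of A A))
      (BTensor.tmul A n (1 : A) : BTensor A N A)
    have h₃ := (congrArg (N.tensorLeftFunctor.map (adj.counit.app (ModuleCat.of A A))).hom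
      h₂).symm.trans h₁
    have h₄ := (map_sum (N.tensorLeftFunctor.map (adj.counit.app (ModuleCat.of A A))).hom
      t Finset.univ).symm.trans h₃
    have h₅ : ∑ i, BTensor.tmul A (op (adjEv adj (x i) n) • y i) (1 : A) =
        BTensor.tmul A n (1 : A) := by
      refine Eq.trans (Finset.sum_congr rfl fun i _ => ?_) h₄
      rw [BTensor.smul_tmul, smul_eq_mul, mul_one]
      rfl
    rw [← BTensor.sum_tmul] at h₅
    exact (BTensor.rid A N).symm.injective h₅

theorem nonempty_iff_adjunction :
    Nonempty (DualPairing M N) ↔ Nonempty (M.tensorLeftFunctor ⊣ N.tensorLeftFunctor) :=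
  ⟨fun ⟨D⟩ => ⟨D.adjunction⟩, fun ⟨adj⟩ => ⟨(exists_of_adjunction adj).choose⟩⟩

end DualPairing

/-! ### Right modules as left modules over opposite rings. -/

namespace RBimod

/-- An `(A, B)`-bimodule as a `(Bᵐᵒᵖ, Aᵐᵒᵖ)`-bimodule. -/
def op (M : RBimod A B) : RBimod Bᵐᵒᵖ Aᵐᵒᵖ where
  carrier := M
  leftModule := M.rightModule
  rightModule := Module.compHom M (RingEquiv.opOp A).symm.toRingHom
  comm := letI := Module.compHom M (RingEquiv.opOp A).symm.toRingHom
    ⟨fun b a m => (smul_comm a.unop.unop b m).symm⟩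

/-- A `(Bᵐᵒᵖ, Aᵐᵒᵖ)`-bimodule as an `(A, B)`-bimodule. -/
def unop (M : RBimod Bᵐᵒᵖ Aᵐᵒᵖ) : RBimod A B where
  carrier := M
  leftModule := Module.compHom M (RingEquiv.opOp A).toRingHom
  rightModule := M.leftModule
  comm := letI := Module.compHom M (RingEquiv.opOp A).toRingHom
    ⟨fun a b m => (smul_comm b (MulOpposite.op (MulOpposite.op a)) m).symm⟩

/-- The bimodules `M.unop.op` and `M` agree. -/
def unopOpIso (M : RBimod Bᵐᵒᵖ Aᵐᵒᵖ) : RBimod.Iso M.unop.op M :=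
  { AddEquiv.refl M with
    map_smul' := fun _ _ => rfl
    map_op_smul' := fun _ _ => rfl }

/-- The isomorphism of opposite bimodules given by an isomorphism of bimodules. -/
def Iso.op {M N : RBimod A B} (e : RBimod.Iso M N) : RBimod.Iso M.op N.op :=
  { e with
    map_smul' := fun b m => e.map_op_smul' b m
    map_op_smul' := fun a m => e.map_smul' a.unop.unop m }

/-- The isomorphism of bimodules given by an isomorphism of opposite bimodules. -/
def Iso.ofOp {M N : RBimod A B} (e : RBimod.Iso M.op N.op) : RBimod.Iso M N :=
  { e with
    map_smul' := fun a m => e.map_op_smul' (MulOpposite.op (MulOpposite.op a)) m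
    map_op_smul' := fun b m => e.map_smul' b m }

/-- The flip `K ⊗_A M ≃ M ⊗_{Aᵐᵒᵖ} K`. -/
def opFlip (M : RBimod A B) (K : ModuleCat.{u} Aᵐᵒᵖ) :
    M.tensorRightFunctor.obj K ≃ₗ[Bᵐᵒᵖ] M.op.tensorLeftFunctor.obj K :=
  let f : BTensor A K M →+ BTensor Aᵐᵒᵖ M.op K :=
    BTensor.liftFun (fun k m => BTensor.tmul Aᵐᵒᵖ (M := M.op) m k)
      (fun k k' m => BTensor.tmul_add Aᵐᵒᵖ (M := M.op) m k k')
      (fun k m m' => BTensor.add_tmul Aᵐᵒᵖ (M := M.op) m m' k)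
      (fun k a m => (BTensor.smul_tmul Aᵐᵒᵖ (M := M.op) m (MulOpposite.op a) k).symm)
  let g : BTensor Aᵐᵒᵖ M.op K →+ BTensor A K M :=
    BTensor.liftFun (fun m k => BTensor.tmul A (N := M) k m)
      (fun m m' k => BTensor.tmul_add A (N := M) k m m')
      (fun m k k' => BTensor.add_tmul A (N := M) k k' m)
      (fun m a k => (BTensor.smul_tmul A (N := M) k a.unop m).symm)
  { AddMonoidHom.toAddEquiv f g (BTensor.hom_ext A fun _ _ => rfl)
      (BTensor.hom_ext Aᵐᵒᵖ fun _ _ => rfl) with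
    map_smul' := fun b z => DFunLike.congr_fun (BTensor.hom_ext A
      (f := f.comp (BTensor.map A LinearMap.id (M.rightMul b)))
      (g := (BTensor.map Aᵐᵒᵖ (M.op.leftMul b) LinearMap.id).comp f) fun _ _ => rfl) z }

/-- Tensoring on the right with `M` is tensoring on the left with `M.op`. -/
def tensorRightIsoOp (M : RBimod A B) : M.tensorRightFunctor ≅ M.op.tensorLeftFunctor :=
  NatIso.ofComponents (fun K => (M.opFlip K).toModuleIso)
    fun _ => tensorRight_hom_ext fun _ _ => rfl

/-- Isomorphic bimodules give isomorphic tensor functors on right modules. -/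
def tensorRightCongr {M N : RBimod A B} (e : RBimod.Iso M N) :
    M.tensorRightFunctor ≅ N.tensorRightFunctor :=
  M.tensorRightIsoOp ≪≫ tensorLeftCongr (e.op) ≪≫ N.tensorRightIsoOp.symm

theorem nonempty_tensorRight_iso_iff {M N : RBimod A B} :
    Nonempty (M.tensorRightFunctor ≅ N.tensorRightFunctor) ↔ Nonempty (RBimod.Iso M N) :=
  ⟨fun ⟨e⟩ => ⟨(isoOfTensorLeftIso
      (M.tensorRightIsoOp.symm ≪≫ e ≪≫ N.tensorRightIsoOp)).ofOp⟩,
    fun ⟨e⟩ => ⟨tensorRightCongr e⟩⟩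

end RBimod

namespace DualPairing

variable {M : RBimod A B} {N : RBimod B A}

/-- A duality is symmetric under reversal of multiplication: the two bimodules exchange roles, and
so do the two dual bases. This reversal turns left adjoints on left modules into right adjoints on
right modules. -/
theorem nonempty_op_iff : Nonempty (DualPairing N.op M.op) ↔ Nonempty (DualPairing M N) := by
  constructor
  · rintro ⟨D⟩
    exact ⟨
      { ev := AddMonoidHom.mk' (fun m => AddMonoidHom.mk' (fun n => (D.ev n m).unop)
          fun n n' => congrArg MulOpposite.unop (DFunLike.congr_fun (map_add D.ev n n') m))
          fun m m' => AddMonoidHom.ext fun n => congrArg MulOpposite.unop (map_add (D.ev n) m m')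
        smul_ev := fun a m n => congrArg MulOpposite.unop (D.ev_smul n m (op a))
        ev_smul := fun m n a => congrArg MulOpposite.unop (D.smul_ev (op a) n m)
        balanced := fun m b n => congrArg MulOpposite.unop (D.balanced n (op b) m).symm
        ι := D.ι
        x := D.y
        y := D.x
        sum_left := D.sum_right
        sum_right := D.sum_left }⟩
  · rintro ⟨D⟩
    exact ⟨
      { ev := AddMonoidHom.mk' (fun n => AddMonoidHom.mk' (fun m => op (D.ev m n))
          fun m m' => congrArg op (DFunLike.congr_fun (map_add D.ev m m') n))
          fun n n' => AddMonoidHom.ext fun m => congrArg op (map_add (D.ev m) n n')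
        smul_ev := fun a n m => congrArg op (D.ev_smul m n a.unop)
        ev_smul := fun n m a => congrArg op (D.smul_ev a.unop m n)
        balanced := fun n b m => congrArg op (D.balanced m b.unop n).symm
        ι := D.ι
        x := D.y
        y := D.x
        sum_left := D.sum_right
        sum_right := D.sum_left }⟩

theorem nonempty_iff_adjunction_right :
    Nonempty (DualPairing M N) ↔ Nonempty (N.tensorRightFunctor ⊣ M.tensorRightFunctor) := by
  rw [← nonempty_op_iff, nonempty_iff_adjunction]
  exact ⟨fun ⟨a⟩ => ⟨(a.ofNatIsoLeft N.tensorRightIsoOp.symm).ofNatIsoRight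
      M.tensorRightIsoOp.symm⟩,
    fun ⟨a⟩ => ⟨(a.ofNatIsoLeft N.tensorRightIsoOp).ofNatIsoRight M.tensorRightIsoOp⟩⟩

theorem nonempty_iff_leftDual : Nonempty (DualPairing M N) ↔
    (Module.Finite A M ∧ Module.Projective A M) ∧ Nonempty (RBimod.Iso N M.leftDual) := by
  refine ⟨fun ⟨D⟩ => ⟨D.fg_projective_left, ⟨D.isoLeftDual⟩⟩, ?_⟩
  rintro ⟨⟨_, _⟩, ⟨e⟩⟩
  exact nonempty_of_isoLeftDual e

theorem nonempty_iff_rightDual : Nonempty (DualPairing M N) ↔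
    (Module.Finite Aᵐᵒᵖ N ∧ Module.Projective Aᵐᵒᵖ N) ∧ Nonempty (RBimod.Iso M N.rightDual) := by
  refine ⟨fun ⟨D⟩ => ⟨D.fg_projective_right, ⟨D.isoRightDual⟩⟩, ?_⟩
  rintro ⟨⟨_, _⟩, ⟨e⟩⟩
  exact nonempty_of_isoRightDual e

end DualPairing

end

section

variable {A B : Type u} [Ring A] [Ring B]

/-! ### The Eilenberg–Watts theorem for left adjoints. -/

section EilenbergWatts

/-- The morphism `B ⟶ K` sending `1` to `k`. -/
def spanHom (K : ModuleCat.{u} B) (k : K) : ModuleCat.of B B ⟶ K :=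
  ModuleCat.ofHom (LinearMap.toSpanSingleton B K k)

theorem spanHom_comp {K L : ModuleCat.{u} B} (k : K) (f : K ⟶ L) :
    spanHom K k ≫ f = spanHom L (f.hom k) := by
  ext
  exact congrArg f.hom (one_smul B k) |>.trans (one_smul B (f.hom k)).symm

theorem spanHom_smul {K : ModuleCat.{u} B} (b : B) (k : K) :
    spanHom K (b • k) = spanHom (ModuleCat.of B B) b ≫ spanHom K k :=
  (spanHom_comp (K := ModuleCat.of B B) b (spanHom K k)).symm

theorem spanHom_add {K : ModuleCat.{u} B} (k k' : K) :
    spanHom K (k + k') = spanHom K k + spanHom K k' := by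
  ext
  exact smul_add (1 : B) k k'

theorem spanHom_zero {K : ModuleCat.{u} B} : spanHom K 0 = 0 := by
  ext
  exact smul_zero (1 : B)

theorem spanHom_one : spanHom (ModuleCat.of B B) (1 : B) = 𝟙 _ := by
  ext
  exact mul_one (1 : B)

theorem hom_eq_spanHom {K : ModuleCat.{u} B} (f : ModuleCat.of B B ⟶ K) :
    f = spanHom K (f.hom (1 : B)) := by
  rw [← spanHom_comp (K := ModuleCat.of B B) (1 : B), spanHom_one, Category.id_comp]

/-- The right adjoint preserves binary products and is therefore additive; additivity passes to its
left adjoint. -/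
theorem CategoryTheory.Adjunction.additive_left {F : ModuleCat.{u} B ⥤ ModuleCat.{u} A}
    {G : ModuleCat.{u} A ⥤ ModuleCat.{u} B} (adj : F ⊣ G) : F.Additive := by
  have := adj.isRightAdjoint
  have : Limits.PreservesLimitsOfSize.{0, 0} G := adj.rightAdjoint_preservesLimits
  have := Functor.additive_of_preserves_binary_products G
  exact adj.left_adjoint_additive

variable (F : ModuleCat.{u} B ⥤ ModuleCat.{u} A) [F.Additive]

/-- The right `B`-module structure on `F(B)`. -/
@[reducible] def wattsModule : Module Bᵐᵒᵖ (F.obj (ModuleCat.of B B)) :=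
  letI : SMul Bᵐᵒᵖ (F.obj (ModuleCat.of B B)) :=
    ⟨fun b m => (F.map (spanHom (ModuleCat.of B B) b.unop)).hom m⟩
  { one_smul := fun m => by
      change (F.map (spanHom (ModuleCat.of B B) (1 : B))).hom m = m
      rw [spanHom_one, F.map_id]; rfl
    mul_smul := fun b b' m => by
      change (F.map (spanHom (ModuleCat.of B B) (b'.unop • b.unop : B))).hom m = _
      rw [spanHom_smul (K := ModuleCat.of B B), F.map_comp]; rfl
    smul_zero := fun b => map_zero (F.map (spanHom (ModuleCat.of B B) b.unop)).hom
    smul_add := fun b => map_add (F.map (spanHom (ModuleCat.of B B) b.unop)).hom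
    add_smul := fun b b' m => by
      change (F.map (spanHom (ModuleCat.of B B) (b.unop + b'.unop : B))).hom m = _
      rw [spanHom_add (K := ModuleCat.of B B), F.map_add]; rfl
    zero_smul := fun m => by
      change (F.map (spanHom (ModuleCat.of B B) (0 : B))).hom m = _
      rw [spanHom_zero (K := ModuleCat.of B B), F.map_zero]; rfl }

/-- The bimodule `F(B)` of an additive functor `F`. -/
def wattsBimodule : RBimod A B where
  carrier := F.obj (ModuleCat.of B B)
  rightModule := wattsModule F
  comm := letI := wattsModule F
    ⟨fun a b m => ((F.map (spanHom (ModuleCat.of B B) b.unop)).hom.map_smul a m).symm⟩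

/-- The comparison map `F(B) ⊗_B K ⟶ F(K)`. -/
def wattsMap (K : ModuleCat.{u} B) : (wattsBimodule F).tensorLeftFunctor.obj K ⟶ F.obj K :=
  (wattsBimodule F).tensorLeftDesc (K := K)
    (AddMonoidHom.flip (AddMonoidHom.mk'
      (fun k => (F.map (spanHom K k)).hom.toAddMonoidHom)
      fun k k' => by rw [spanHom_add, F.map_add]; rfl))
    (fun m b k => by
      change (F.map (spanHom K k)).hom ((F.map (spanHom (ModuleCat.of B B) b)).hom m) =
        (F.map (spanHom K (b • k))).hom m
      rw [spanHom_smul, F.map_comp]; rfl)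
    (fun a m k => (F.map (spanHom K k)).hom.map_smul a m)

/-- The map `m ↦ φ(m ⊗ k)` for `φ : F(B) ⊗_B K ⟶ L`. -/
def wattsSlice {K : ModuleCat.{u} B} {L : ModuleCat.{u} A}
    (φ : (wattsBimodule F).tensorLeftFunctor.obj K ⟶ L) (k : K) :
    F.obj (ModuleCat.of B B) ⟶ L :=
  ModuleCat.ofHom (X := F.obj (ModuleCat.of B B))
    { toFun := fun m => φ.hom (BTensor.tmul B (M := wattsBimodule F) m k)
      map_add' := fun m m' =>
        (congrArg φ.hom (BTensor.add_tmul B (M := wattsBimodule F) m m' k)).trans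
          (map_add φ.hom _ _)
      map_smul' := fun a m => φ.hom.map_smul a
        (BTensor.tmul B (M := wattsBimodule F) m k : BTensor B (wattsBimodule F) K) }

/-- By Yoneda it suffices that composing with the comparison map is a bijection on morphisms into
every L. Under the adjunction, a map out of F(B) ⊗ K becomes a linear map K → G(L), which is the
same as a map F(K) → L. No presentation of K and no right exactness argument is needed. -/
theorem wattsMap_isIso {G : ModuleCat.{u} A ⥤ ModuleCat.{u} B} (adj : F ⊣ G)
    (K : ModuleCat.{u} B) : IsIso (wattsMap F K) := by
  refine isIso_of_coyoneda_map_bijective _ fun L => ⟨fun f g h => ?_, fun φ => ?_⟩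
  · apply (adj.homEquiv K L).injective
    ext k
    -- Maps that agree after composition with the comparison map have transposes agreeing on every
    -- map B → K, hence on every element k.
    have h₁ : F.map (spanHom K k) ≫ f = F.map (spanHom K k) ≫ g := by
      ext m
      exact congrArg (fun f => f.hom (BTensor.tmul B (M := wattsBimodule F) m k)) h
    have h₂ := congrArg (adj.homEquiv _ _) h₁
    rw [adj.homEquiv_naturality_left, adj.homEquiv_naturality_left] at h₂
    have h₃ := congrArg (fun f => f.hom (1 : B)) h₂
    have h₄ : (spanHom K k).hom (1 : B) = k := one_smul B k
    change (adj.homEquiv K L f).hom ((spanHom K k).hom (1 : B)) =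
      (adj.homEquiv K L g).hom ((spanHom K k).hom (1 : B)) at h₃
    rwa [h₄] at h₃
  -- Each slice φ(- ⊗ k) : F(B) → L transposes to a map B → G(L); its value at 1, as a function of
  -- k, is the required linear map.
  · let s (k : K) : ModuleCat.of B B ⟶ G.obj L := adj.homEquiv _ _ (wattsSlice F φ k)
    have hadd (k k' : K) : s (k + k') = s k + s k' := by
      refine Eq.trans (congrArg (adj.homEquiv _ _) ?_) (adj.homAddEquiv_add _ _ _ _)
      ext m
      exact (congrArg φ.hom (BTensor.tmul_add B (M := wattsBimodule F) m k k')).trans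
        (map_add φ.hom _ _)
    have hsmul (b : B) (k : K) : s (b • k) = spanHom (ModuleCat.of B B) b ≫ s k := by
      refine Eq.trans (congrArg (adj.homEquiv _ _) ?_) (adj.homEquiv_naturality_left _ _)
      ext m
      exact (congrArg φ.hom (BTensor.smul_tmul B (M := wattsBimodule F) m b k)).symm
    let ψ : K ⟶ G.obj L := ModuleCat.ofHom
      { toFun := fun k => (s k).hom (1 : B)
        map_add' := fun k k' => by rw [hadd]; rfl
        map_smul' := fun b k => by
          rw [hsmul]
          refine Eq.trans ?_ ((s k).hom.map_smul b (1 : B))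
          refine congrArg (s k).hom ?_
          change (1 : B) • b = b • (1 : B)
          simp }
    refine ⟨(adj.homEquiv K L).symm ψ, RBimod.tensorLeft_hom_ext fun m k => ?_⟩
    have h₁ : F.map (spanHom K k) ≫ (adj.homEquiv K L).symm ψ = wattsSlice F φ k := by
      rw [← adj.homEquiv_naturality_left_symm, Equiv.symm_apply_eq, spanHom_comp,
        hom_eq_spanHom (adj.homEquiv _ _ (wattsSlice F φ k))]
      rfl
    exact congrArg (fun f => f.hom m) h₁

/-- The Eilenberg–Watts theorem for left adjoint functors. -/
theorem exists_iso_tensorLeft {F : ModuleCat.{u} B ⥤ ModuleCat.{u} A}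
    {G : ModuleCat.{u} A ⥤ ModuleCat.{u} B} (adj : F ⊣ G) :
    ∃ M : RBimod A B, Nonempty (F ≅ M.tensorLeftFunctor) := by
  have := adj.additive_left
  have (K : ModuleCat.{u} B) := wattsMap_isIso F adj K
  refine ⟨wattsBimodule F, ⟨(NatIso.ofComponents (fun K => asIso (wattsMap F K))
    fun {K K'} f => RBimod.tensorLeft_hom_ext fun m k => ?_).symm⟩⟩
  change (F.map (spanHom K' (f.hom k))).hom m = (F.map f).hom ((F.map (spanHom K k)).hom m)
  rw [← spanHom_comp, F.map_comp]; rfl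

/-- The Eilenberg–Watts theorem for left adjoint functors between right modules. -/
theorem exists_iso_tensorRight {F : ModuleCat.{u} Aᵐᵒᵖ ⥤ ModuleCat.{u} Bᵐᵒᵖ}
    {G : ModuleCat.{u} Bᵐᵒᵖ ⥤ ModuleCat.{u} Aᵐᵒᵖ} (adj : F ⊣ G) :
    ∃ M : RBimod A B, Nonempty (F ≅ M.tensorRightFunctor) := by
  obtain ⟨M, ⟨e⟩⟩ := exists_iso_tensorLeft adj
  exact ⟨M.unop, ⟨e ≪≫ RBimod.tensorLeftCongr M.unopOpIso.symm ≪≫ M.unop.tensorRightIsoOp.symm⟩⟩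

end EilenbergWatts

end

/-! ### Strict Morita contexts, their dualities and their rigidity. -/

section

variable {A B : Type u} [Ring A] [Ring B]

namespace DualPairing

variable {M M' : RBimod A B} {N : RBimod B A}

/-- Transport of a duality along an isomorphism of the first bimodule. -/
def congrLeft (D : DualPairing M N) (e : RBimod.Iso M' M) : DualPairing M' N where
  ev := D.ev.comp e.toAddEquiv.toAddMonoidHom
  smul_ev a m n := (congrArg (fun t => D.ev t n) (e.map_smul a m)).trans (D.smul_ev a _ n)
  ev_smul m n a := D.ev_smul _ n a
  balanced m b n := (congrArg (fun t => D.ev t n) (e.map_op_smul (op b) m)).trans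
    (D.balanced _ b n)
  ι := D.ι
  x := fun i => e.toAddEquiv.symm (D.x i)
  y := D.y
  sum_left m := by
    apply e.toAddEquiv.injective
    rw [map_sum]
    refine Eq.trans (Finset.sum_congr rfl fun i _ => ?_) (D.sum_left (e.toAddEquiv m))
    rw [e.map_smul, AddEquiv.apply_symm_apply]
    rfl
  sum_right n := by
    refine Eq.trans (Finset.sum_congr rfl fun i _ => ?_) (D.sum_right n)
    exact congrArg (fun t => op (D.ev t n) • D.y i) (e.toAddEquiv.apply_symm_apply (D.x i))

/-- Both N and N' are the left dual of M through their pairings, so the dual partner is unique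
compatibly with the pairing. -/
theorem exists_iso {N' : RBimod B A} (D : DualPairing M N) (D' : DualPairing M N') :
    ∃ e : RBimod.Iso N N', ∀ m n, D'.ev m (e.toAddEquiv n) = D.ev m n := by
  refine ⟨D.isoLeftDual.trans D'.isoLeftDual.symm, fun m n => ?_⟩
  exact LinearMap.congr_fun (D'.isoLeftDual.toAddEquiv.apply_symm_apply
    (D.isoLeftDual.toAddEquiv n)) m

end DualPairing

namespace MoritaContext

/-- Exchange of the two sides of a Morita context. -/
def swap (U : MoritaContext A B) : MoritaContext B A where
  P := U.Q
  Q := U.P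
  f := U.g
  g := U.f
  assoc_left := U.assoc_right
  assoc_right := U.assoc_left

theorem IsStrict.swap {U : MoritaContext A B} (h : U.IsStrict) : U.swap.IsStrict := ⟨h.2, h.1⟩

/-- The pairing `P ⊗_B Q → A` as an additive map. -/
def fHom (U : MoritaContext A B) : BTensor B U.P U.Q →+ A := U.f.toAddMonoidHom

/-- The pairing `Q ⊗_A P → B` as an additive map. -/
def gHom (U : MoritaContext A B) : BTensor A U.Q U.P →+ B := U.g.toAddMonoidHom

theorem fHom_smul (U : MoritaContext A B) (p : U.P) (q : U.Q) (p' : U.P) :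
    U.fHom (BTensor.tmul B p q) • p' = op (U.gHom (BTensor.tmul A q p')) • p :=
  U.assoc_left p q p'

theorem gHom_smul (U : MoritaContext A B) (q : U.Q) (p : U.P) (q' : U.Q) :
    U.gHom (BTensor.tmul A q p) • q' = op (U.fHom (BTensor.tmul B p q')) • q :=
  U.assoc_right q p q'

theorem gHom_op_smul (U : MoritaContext A B) (q : U.Q) (p : U.P) (b : B) :
    U.gHom (BTensor.tmul A q (op b • p)) = U.gHom (BTensor.tmul A q p) * b :=
  U.g.map_op_smul' (op b) (BTensor.tmul A q p)

theorem IsStrict.nonempty_iso {U : MoritaContext A B} (h : U.IsStrict) :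
    Nonempty (RBimod.Iso (U.P.tensor U.Q) (RBimod.self A)) :=
  ⟨{ AddEquiv.ofBijective U.f.toAddMonoidHom h.1 with
    map_smul' := U.f.map_smul'
    map_op_smul' := U.f.map_op_smul' }⟩

theorem IsStrict.exists_sum_eq_one {U : MoritaContext A B} (h : U.IsStrict) :
    ∃ (ι : Type) (_ : Fintype ι) (y : ι → U.Q) (x : ι → U.P),
      ∑ i, U.gHom (BTensor.tmul A (y i) (x i)) = 1 := by
  obtain ⟨z, hz⟩ := h.2.2 (1 : B)
  obtain ⟨ι, i, y, x, hxy⟩ := BTensor.exists_eq_sum (B := A) (M := U.Q) (N := U.P) z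
  refine ⟨ι, i, y, x, ?_⟩
  rw [← map_sum, ← hxy]
  exact hz

/-- Writing 1 = Σ g(yᵢ ⊗ xᵢ) produces dual bases: associativity gives Σ f(p ⊗ yᵢ) xᵢ = Σ p g(yᵢ ⊗
xᵢ) = p, and likewise for Q. -/
theorem IsStrict.exists_dualPairing {U : MoritaContext A B} (h : U.IsStrict) :
    ∃ D : DualPairing U.P U.Q, ∀ p q, D.ev p q = U.f (BTensor.tmul B p q) := by
  obtain ⟨ι, _, y, x, hxy⟩ := h.exists_sum_eq_one
  let F := U.fHom
  refine ⟨
    { ev := AddMonoidHom.mk' (fun p => F.comp (BTensor.tmulHom B U.P U.Q p))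
        fun p p' => AddMonoidHom.ext fun q =>
          (congrArg F (BTensor.add_tmul B p p' q)).trans (map_add F _ _)
      smul_ev := fun a p q => U.f.map_smul' a (BTensor.tmul B p q)
      ev_smul := fun p q a => U.f.map_op_smul' (op a) (BTensor.tmul B p q)
      balanced := fun p b q => congrArg F (BTensor.smul_tmul B p b q)
      ι := ι
      x := x
      y := y
      sum_left := fun p => ?_
      sum_right := fun q => ?_ }, fun _ _ => rfl⟩
  · refine (Finset.sum_congr rfl fun i _ => U.fHom_smul p (y i) (x i)).trans ?_
    rw [← Finset.sum_smul, ← Finset.op_sum, hxy, op_one, one_smul]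
  · refine (Finset.sum_congr rfl fun i _ => (U.gHom_smul (y i) (x i) q).symm).trans ?_
    rw [← Finset.sum_smul, hxy, one_smul]

/-- P is faithful on the right because b = Σ g(yᵢ ⊗ xᵢ) b = Σ g(yᵢ ⊗ xᵢ b) is recovered from its
action on the xᵢ. -/
theorem IsStrict.eq_of_op_smul_eq {U : MoritaContext A B} (h : U.IsStrict) {b b' : B}
    (hb : ∀ p : U.P, op b • p = op b' • p) : b = b' := by
  obtain ⟨ι, _, y, x, hxy⟩ := h.exists_sum_eq_one
  have key (b : B) : b = ∑ i, U.gHom (BTensor.tmul A (y i) (op b • x i)) := by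
    simp_rw [gHom_op_smul, ← Finset.sum_mul, hxy, one_mul]
  rw [key b, key b']
  simp_rw [hb]

/-- A strict Morita context is determined up to isomorphism by its first bimodule. -/
theorem isomorphic_of_iso {U W : MoritaContext A B} (hU : U.IsStrict) (hW : W.IsStrict)
    (e : RBimod.Iso U.P W.P) : U.Isomorphic W := by
  obtain ⟨D, hD⟩ := hU.exists_dualPairing
  obtain ⟨D', hD'⟩ := hW.exists_dualPairing
  -- The second isomorphism is forced: both second bimodules are dual to the same P, so
  -- compatibility with f holds by construction.
  obtain ⟨e', he'⟩ := D.exists_iso (D'.congrLeft e)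
  have hf (p : U.P) (q : U.Q) :
      W.f (BTensor.tmul B (e p) (e' q)) = U.f (BTensor.tmul B p q) :=
    (hD' _ _).symm.trans ((he' p q).trans (hD p q))
  -- Compatibility with g is tested by the faithful right action on P, where associativity converts
  -- g into f.
  refine ⟨e, e', hf, fun q p => hW.eq_of_op_smul_eq fun p₀ => ?_⟩
  obtain ⟨p₀, rfl⟩ := e.toAddEquiv.surjective p₀
  refine (W.assoc_left (e p₀) (e' q) (e p)).symm.trans ?_
  rw [hf]
  refine (e.map_smul (U.f (BTensor.tmul B p₀ q)) p).symm.trans ?_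
  refine (congrArg e.toAddEquiv (U.assoc_left p₀ q p)).trans ?_
  exact e.map_op_smul _ _

end MoritaContext

namespace RBimod

/-- The isomorphism `M ⊗_B B ≅ M` of left modules. -/
def ridIso (M : RBimod A B) : M.tensorLeftFunctor.obj (ModuleCat.of B B) ≅ ModuleCat.of A M :=
  LinearEquiv.toModuleIso
    ({ BTensor.rid B M with
      map_smul' := fun a z => DFunLike.congr_fun (BTensor.hom_ext B
        (f := (BTensor.rid B M).toAddMonoidHom.comp (BTensor.map B (M.leftMul a) LinearMap.id))
        (g := (M.leftMul a).toAddMonoidHom.comp (BTensor.rid B M).toAddMonoidHom)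
        fun m b => (smul_comm a (MulOpposite.op b) m).symm) z } :
      M.tensorLeftFunctor.obj (ModuleCat.of B B) ≃ₗ[A] M)

end RBimod

theorem ModuleCat.bijective_hom {K L : ModuleCat.{u} A} (f : K ⟶ L) [IsIso f] :
    Function.Bijective f.hom :=
  ConcreteCategory.bijective_of_isIso f

/-- An adjoint equivalence of tensor functors yields a strict Morita context. -/
theorem exists_strict_of_adjunction {P : RBimod A B} {Q : RBimod B A}
    (adj : P.tensorLeftFunctor ⊣ Q.tensorLeftFunctor) [IsIso adj.unit] [IsIso adj.counit] :
    ∃ U : MoritaContext A B, U.IsStrict ∧ U.P = P := by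
  obtain ⟨D, hD, hxy⟩ := DualPairing.exists_of_adjunction adj
  let f : BTensor B P Q →+ A := BTensor.lift D.ev D.balanced
  -- Up to the identification Q ⊗ A ≅ Q, the pairing f is the counit at A.
  have hf : Function.Bijective f := by
    rw [← Function.Bijective.of_comp_iff f
      (ModuleCat.bijective_hom (P.tensorLeftFunctor.map Q.ridIso.hom))]
    have h : f ∘ (P.tensorLeftFunctor.map Q.ridIso.hom).hom =
        (adj.counit.app (ModuleCat.of A A)).hom := by
      funext z
      refine DFunLike.congr_fun (BTensor.hom_ext_right
        (f := f.comp (P.tensorLeftFunctor.map Q.ridIso.hom).hom.toAddMonoidHom)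
        (g := (adj.counit.app (ModuleCat.of A A)).hom.toAddMonoidHom) fun p q a => ?_) z
      refine (D.ev_smul p q a).trans ?_
      rw [hD]
      exact (DualPairing.adj_counit_tmul adj (ModuleCat.of A A) p q a).symm
    exact h ▸ ModuleCat.bijective_hom (adj.counit.app (ModuleCat.of A A))
  -- Likewise c is the unit at B after P ⊗ B ≅ P. It is a bijective bimodule map, and its inverse
  -- serves as the second pairing g.
  let c : B →+ BTensor A Q P := AddMonoidHom.mk'
    (fun b => ∑ i, BTensor.tmul A (D.y i) (op b • D.x i)) fun b b' => by
      simp only [MulOpposite.op_add, add_smul, BTensor.tmul_add, Finset.sum_add_distrib]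
  have hc : Function.Bijective c := by
    have h := (ModuleCat.bijective_hom (Q.tensorLeftFunctor.map P.ridIso.hom)).comp
      (ModuleCat.bijective_hom (adj.unit.app (ModuleCat.of B B)))
    have h' : (Q.tensorLeftFunctor.map P.ridIso.hom).hom ∘
        (adj.unit.app (ModuleCat.of B B)).hom = c := by
      funext b
      refine (congrArg (Q.tensorLeftFunctor.map P.ridIso.hom).hom
        (DualPairing.adj_unit_apply adj hxy (ModuleCat.of B B) b)).trans ?_
      exact map_sum (Q.tensorLeftFunctor.map P.ridIso.hom).hom
        (fun i => (BTensor.tmul A (D.y i) (BTensor.tmul B (D.x i) b) :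
          BTensor A Q (BTensor B P B))) Finset.univ
    exact h' ▸ h
  have hcr (b b' : B) : c (b' * b) = BTensor.map A LinearMap.id (P.rightMul (op b)) (c b') := by
    refine Eq.trans (Finset.sum_congr rfl fun i _ => ?_) (map_sum _ _ _).symm
    rw [MulOpposite.op_mul, mul_smul]
    rfl
  have hcl (b b' : B) : c (b * b') = BTensor.map A (Q.leftMul b) LinearMap.id (c b') := by
    refine Eq.trans ?_ (map_sum _ _ _).symm
    refine Eq.trans (Finset.sum_congr rfl fun i _ => ?_)
      (D.coev_central (P.rightMul (op b')) b).symm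
    rw [MulOpposite.op_mul, mul_smul]
    rfl
  let E : B ≃+ BTensor A Q P := AddEquiv.ofBijective c hc
  have hE (z : BTensor A Q P) : c (E.symm z) = z := E.apply_symm_apply z
  refine ⟨
    { P := P
      Q := Q
      f :=
        { f with
          map_smul' := fun a z => DFunLike.congr_fun (BTensor.hom_ext B
            (f := f.comp (BTensor.map B (P.leftMul a) LinearMap.id))
            (g := (AddMonoidHom.mulLeft a).comp f) fun p q => D.smul_ev a p q) z
          map_op_smul' := fun a z => DFunLike.congr_fun (BTensor.hom_ext B
            (f := f.comp (BTensor.map B LinearMap.id (Q.rightMul a)))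
            (g := (AddMonoidHom.mulRight a.unop).comp f) fun p q => D.ev_smul p q a.unop) z }
      g :=
        { E.symm.toAddMonoidHom with
          map_smul' := fun b z => by
            apply hc.1
            refine (hE _).trans ?_
            refine Eq.trans ?_ (hcl b (E.symm z)).symm
            exact congrArg (BTensor.map A (Q.leftMul b) LinearMap.id) (hE z).symm
          map_op_smul' := fun b z => by
            apply hc.1
            refine (hE _).trans ?_
            refine Eq.trans ?_ (hcr b.unop (E.symm z)).symm
            exact congrArg (BTensor.map A LinearMap.id (P.rightMul b)) (hE z).symm }
      assoc_left := fun p q p' => ?_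
      assoc_right := fun q p q' => ?_ }, ⟨hf, E.symm.bijective⟩, rfl⟩
  -- With q ⊗ p' = c(b) = Σ yᵢ ⊗ xᵢ b, applying ev(p, -) gives Σ ev(p, yᵢ) xᵢ b = p b.
  · change D.ev p q • p' = op (E.symm (BTensor.tmul A q p')) • p
    obtain ⟨b, hb⟩ := hc.2 (BTensor.tmul A q p')
    have h : E.symm (BTensor.tmul A q p') = b := E.symm_apply_eq.2 hb.symm
    rw [h]
    refine (congrArg (D.evSMul P p) hb).symm.trans ((map_sum _ _ _).trans ?_)
    conv_rhs => rw [← D.sum_left p, Finset.smul_sum]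
    exact Finset.sum_congr rfl fun i _ => smul_comm _ _ _
  -- With q ⊗ p = c(b), this is Σ yᵢ ev(xᵢ b, q') = Σ yᵢ ev(xᵢ, b q') = b q'.
  · change (E.symm (BTensor.tmul A q p)) • q' = op (D.ev p q') • q
    obtain ⟨b, hb⟩ := hc.2 (BTensor.tmul A q p)
    have h : E.symm (BTensor.tmul A q p) = b := E.symm_apply_eq.2 hb.symm
    rw [h]
    let k : BTensor A Q P →+ Q := BTensor.liftFun (fun q p => op (D.ev p q') • q)
      (fun _ _ _ => smul_add _ _ _)
      (fun q p p' => by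
        rw [map_add, AddMonoidHom.add_apply, MulOpposite.op_add, add_smul])
      (fun q a p => by rw [D.smul_ev, MulOpposite.op_mul, mul_smul])
    refine Eq.symm ((congrArg k hb).symm.trans ((map_sum _ _ _).trans ?_))
    conv_rhs => rw [← D.sum_right (b • q')]
    exact Finset.sum_congr rfl fun i _ => congrArg (fun t => op t • D.y i) (D.balanced _ _ _)

end

/-! ### Conjugation of functors and adjunctions by equivalences. -/

section Conjugation

variable {C C' D D' : Type*} [Category C] [Category C'] [Category D] [Category D']

/-- Conjugating by equivalences and back gives the original functor. -/
def conjugateInvIso (E : C ≌ C') (E' : D ≌ D') (K : C ⥤ D') :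
    E.functor ⋙ (E.inverse ⋙ K ⋙ E'.inverse) ⋙ E'.functor ≅ K :=
  E.funInvIdAssoc (K ⋙ E'.inverse ⋙ E'.functor) ≪≫
    Functor.isoWhiskerLeft K E'.counitIso ≪≫ K.rightUnitor

theorem nonempty_iso_conjugate_iff (E : C ≌ C') (E' : D ≌ D') (H : C' ⥤ D) (K : C ⥤ D') :
    Nonempty (H ≅ E.inverse ⋙ K ⋙ E'.inverse) ↔
      Nonempty (E.functor ⋙ H ⋙ E'.functor ≅ K) :=
  ⟨fun ⟨e⟩ => ⟨Functor.isoWhiskerLeft E.functor (Functor.isoWhiskerRight e E'.functor) ≪≫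
      conjugateInvIso E E' K⟩,
    fun ⟨e⟩ => ⟨(conjugateInvIso E.symm E'.symm H).symm ≪≫
      Functor.isoWhiskerLeft E.inverse (Functor.isoWhiskerRight e E'.inverse)⟩⟩

/-- Conjugation of an adjunction by equivalences. -/
def CategoryTheory.Adjunction.conjugate {H : C ⥤ D} {K : D ⥤ C} (adj : H ⊣ K)
    (E : C' ≌ C) (E' : D ≌ D') :
    E.functor ⋙ H ⋙ E'.functor ⊣ E'.inverse ⋙ K ⋙ E.inverse :=
  E.toAdjunction.comp (adj.comp E'.toAdjunction)

/-- Moves both equivalences from the left adjoint to the right adjoint: passing to adjoints inverts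
them, and cancelling those inverses on the right side leaves E and E' themselves. -/
theorem nonempty_adjunction_conjugate_iff (E : C ≌ C') (E' : D ≌ D') (H : C' ⥤ D)
    (K : D' ⥤ C) :
    Nonempty (E.functor ⋙ H ⋙ E'.functor ⊣ K) ↔
      Nonempty (H ⊣ E'.functor ⋙ K ⋙ E.functor) :=
  ⟨fun ⟨a⟩ => ⟨(a.conjugate E.symm E'.symm).ofNatIsoLeft (conjugateInvIso E.symm E'.symm H)⟩,
    fun ⟨a⟩ => ⟨(a.conjugate E E').ofNatIsoRight (conjugateInvIso E'.symm E.symm K)⟩⟩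

theorem IsFrobeniusPair.of_iso {F F' : C ⥤ D} {G G' : D ⥤ C} {α α' : C ⥤ C} {β β' : D ⥤ D}
    (h : IsFrobeniusPair F G α β) (eF : F ≅ F') (eG : G ≅ G') (eα : α ≅ α') (eβ : β ≅ β') :
    IsFrobeniusPair F' G' α' β' := by
  obtain ⟨⟨a⟩, ⟨b⟩⟩ := h
  exact ⟨⟨(a.ofNatIsoLeft eF).ofNatIsoRight eG⟩,
    ⟨(b.ofNatIsoLeft eG).ofNatIsoRight (Functor.isoWhiskerRight eα _ ≪≫
      Functor.isoWhiskerLeft _ (Functor.isoWhiskerRight eF _ ≪≫ Functor.isoWhiskerLeft _ eβ))⟩⟩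

end Conjugation

/-! ### Invertible bimodules and equivalences of module categories. -/

section Invertible

variable {A B : Type u} [Ring A] [Ring B]

namespace RBimod

/-- The functor isomorphism for a triple tensor product. -/
def tensorLeftTriple {A' B' : Type u} [Ring A'] [Ring B'] (M : RBimod A' A) (N : RBimod A B)
    (P : RBimod B B') : (M.tensor (N.tensor P)).tensorLeftFunctor ≅
      P.tensorLeftFunctor ⋙ N.tensorLeftFunctor ⋙ M.tensorLeftFunctor :=
  (tensorLeftComp M (N.tensor P)).symm ≪≫
    Functor.isoWhiskerRight (tensorLeftComp N P).symm M.tensorLeftFunctor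

/-- The functor isomorphism for a triple tensor product, bracketed to the left. -/
def tensorLeftTriple' {A' B' : Type u} [Ring A'] [Ring B'] (M : RBimod A' A) (N : RBimod A B)
    (P : RBimod B B') : ((M.tensor N).tensor P).tensorLeftFunctor ≅
      P.tensorLeftFunctor ⋙ N.tensorLeftFunctor ⋙ M.tensorLeftFunctor :=
  (tensorLeftComp (M.tensor N) P).symm ≪≫
    Functor.isoWhiskerLeft P.tensorLeftFunctor (tensorLeftComp M N).symm

/-- The functor isomorphism for a triple tensor product on the right. -/
def tensorRightTriple {A' B' : Type u} [Ring A'] [Ring B'] (M : RBimod A' A) (N : RBimod A B)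
    (P : RBimod B B') : ((M.tensor N).tensor P).tensorRightFunctor ≅
      M.tensorRightFunctor ⋙ N.tensorRightFunctor ⋙ P.tensorRightFunctor :=
  (tensorRightComp (M.tensor N) P).symm ≪≫
    Functor.isoWhiskerRight (tensorRightComp M N).symm P.tensorRightFunctor

variable {P : RBimod A B} {Q : RBimod B A}

/-- An invertible bimodule yields an equivalence of categories of left modules. -/
def leftEquivalence (e : RBimod.Iso (P.tensor Q) (self A)) (e' : RBimod.Iso (Q.tensor P) (self B)) :
    ModuleCat.{u} B ≌ ModuleCat.{u} A :=
  CategoryTheory.Equivalence.mk P.tensorLeftFunctor Q.tensorLeftFunctor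
    (tensorLeftComp Q P ≪≫ tensorLeftCongr e' ≪≫ tensorLeftSelf B).symm
    (tensorLeftComp P Q ≪≫ tensorLeftCongr e ≪≫ tensorLeftSelf A)

theorem isEquivalence_left_iff :
    P.tensorLeftFunctor.IsEquivalence ↔ ∃ Q : RBimod B A,
      Nonempty (RBimod.Iso (P.tensor Q) (self A)) ∧
        Nonempty (RBimod.Iso (Q.tensor P) (self B)) := by
  refine ⟨fun h => ?_, fun ⟨Q, ⟨e⟩, ⟨e'⟩⟩ => (leftEquivalence e e').isEquivalence_functor⟩
  let E := P.tensorLeftFunctor.asEquivalence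
  obtain ⟨Q, ⟨i⟩⟩ := exists_iso_tensorLeft E.symm.toAdjunction
  refine ⟨Q, nonempty_tensorLeft_iso_iff.1 ⟨?_⟩, nonempty_tensorLeft_iso_iff.1 ⟨?_⟩⟩
  · exact (tensorLeftComp P Q).symm ≪≫ Functor.isoWhiskerRight i.symm P.tensorLeftFunctor ≪≫
      E.counitIso ≪≫ (tensorLeftSelf A).symm
  · exact (tensorLeftComp Q P).symm ≪≫ Functor.isoWhiskerLeft P.tensorLeftFunctor i.symm ≪≫
      E.unitIso.symm ≪≫ (tensorLeftSelf B).symm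

/-- The criterion is the same two-sided invertibility as for left modules, so P gives an equivalence
on one side exactly when it does on the other. -/
theorem isEquivalence_right_iff :
    P.tensorRightFunctor.IsEquivalence ↔ ∃ Q : RBimod B A,
      Nonempty (RBimod.Iso (P.tensor Q) (self A)) ∧
        Nonempty (RBimod.Iso (Q.tensor P) (self B)) := by
  refine ⟨fun h => ?_, fun ⟨Q, ⟨e⟩, ⟨e'⟩⟩ => ?_⟩
  · let E := P.tensorRightFunctor.asEquivalence
    obtain ⟨Q, ⟨i⟩⟩ := exists_iso_tensorRight E.symm.toAdjunction
    refine ⟨Q, nonempty_tensorRight_iso_iff.1 ⟨?_⟩, nonempty_tensorRight_iso_iff.1 ⟨?_⟩⟩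
    · exact (tensorRightComp P Q).symm ≪≫ Functor.isoWhiskerLeft P.tensorRightFunctor i.symm ≪≫
        E.unitIso.symm ≪≫ (tensorRightSelf A).symm
    · exact (tensorRightComp Q P).symm ≪≫ Functor.isoWhiskerRight i.symm P.tensorRightFunctor ≪≫
        E.counitIso ≪≫ (tensorRightSelf B).symm
  · exact (CategoryTheory.Equivalence.mk P.tensorRightFunctor Q.tensorRightFunctor
      (tensorRightComp P Q ≪≫ tensorRightCongr e ≪≫ tensorRightSelf A).symm
      (tensorRightComp Q P ≪≫ tensorRightCongr e' ≪≫ tensorRightSelf B)).isEquivalence_functor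

/-- An adjoint equivalence is used rather than two unrelated isomorphisms P ⊗ Q ≅ A and Q ⊗ P ≅ B,
since the triangle identities are what make the two pairings associative. -/
theorem exists_strict_of_isEquivalence (h : P.tensorLeftFunctor.IsEquivalence) :
    ∃ U : MoritaContext A B, U.IsStrict ∧ U.P = P := by
  let E := P.tensorLeftFunctor.asEquivalence
  obtain ⟨Q, ⟨i⟩⟩ := exists_iso_tensorLeft E.symm.toAdjunction
  have : E.inverse.IsEquivalence := E.isEquivalence_inverse
  have : Q.tensorLeftFunctor.IsEquivalence := Functor.isEquivalence_of_iso i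
  let adj : P.tensorLeftFunctor ⊣ Q.tensorLeftFunctor := E.toAdjunction.ofNatIsoRight i
  have : IsIso adj.unit := adj.unit_isIso_of_L_fully_faithful
  have : IsIso adj.counit := adj.counit_isIso_of_R_fully_faithful
  exact exists_strict_of_adjunction adj

end RBimod

namespace MoritaContext

variable {U : MoritaContext A B}

/-- The equivalence of categories of left modules given by a strict Morita context. -/
noncomputable def IsStrict.equivalence (h : U.IsStrict) : ModuleCat.{u} B ≌ ModuleCat.{u} A :=
  RBimod.leftEquivalence h.nonempty_iso.some h.swap.nonempty_iso.some

theorem IsStrict.isEquivalence_left (h : U.IsStrict) : U.P.tensorLeftFunctor.IsEquivalence :=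
  h.equivalence.isEquivalence_functor

theorem IsStrict.isEquivalence_right (h : U.IsStrict) : U.P.tensorRightFunctor.IsEquivalence :=
  RBimod.isEquivalence_right_iff.2 (RBimod.isEquivalence_left_iff.1 h.isEquivalence_left)

end MoritaContext

end Invertible

/-! ### The two conditions on fourtuples as pairs of dualities and as Frobenius pairs. -/

section Conditions

variable {R S : Type u} [Ring R] [Ring S] {X : RBimod R S} {Λ : RBimod S R}
  {U : MoritaContext R R} {V : MoritaContext S S}

/-- On tensor functors, the two sides differ by conjugation with the equivalences given by U and V.
-/
theorem nonempty_iso_sandwich_iff (hU : U.IsStrict) (hV : V.IsStrict) (Y Z : RBimod S R) :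
    Nonempty (RBimod.Iso Y (V.Q.tensor (Z.tensor U.Q))) ↔
      Nonempty (RBimod.Iso (V.P.tensor (Y.tensor U.P)) Z) := by
  rw [← RBimod.nonempty_tensorLeft_iso_iff, ← RBimod.nonempty_tensorLeft_iso_iff]
  refine Iff.trans ?_ ((nonempty_iso_conjugate_iff hU.equivalence hV.equivalence
    Y.tensorLeftFunctor Z.tensorLeftFunctor).trans ?_)
  · exact ⟨fun ⟨e⟩ => ⟨e ≪≫ RBimod.tensorLeftTriple V.Q Z U.Q⟩,
      fun ⟨e⟩ => ⟨e ≪≫ (RBimod.tensorLeftTriple V.Q Z U.Q).symm⟩⟩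
  · exact ⟨fun ⟨e⟩ => ⟨RBimod.tensorLeftTriple V.P Y U.P ≪≫ e⟩,
      fun ⟨e⟩ => ⟨(RBimod.tensorLeftTriple V.P Y U.P).symm ≪≫ e⟩⟩

/-- A functorial form of finite projectivity, visibly stable under composition with equivalences. -/
theorem fg_projective_right_iff_exists (Y : RBimod S R) :
    (Module.Finite Rᵐᵒᵖ Y ∧ Module.Projective Rᵐᵒᵖ Y) ↔
      ∃ M : RBimod R S, Nonempty (M.tensorLeftFunctor ⊣ Y.tensorLeftFunctor) := by
  simp_rw [← DualPairing.nonempty_iff_adjunction, DualPairing.nonempty_iff_rightDual]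
  exact ⟨fun h => ⟨_, h, ⟨RBimod.Iso.refl _⟩⟩, fun ⟨_, h, _⟩ => h⟩

theorem fg_projective_right_sandwich (hU : U.IsStrict) (hV : V.IsStrict) {Y : RBimod S R}
    (h : Module.Finite Rᵐᵒᵖ Y ∧ Module.Projective Rᵐᵒᵖ Y) :
    Module.Finite Rᵐᵒᵖ (V.P.tensor (Y.tensor U.P)) ∧
      Module.Projective Rᵐᵒᵖ (V.P.tensor (Y.tensor U.P)) := by
  rw [fg_projective_right_iff_exists] at h ⊢
  obtain ⟨M, ⟨a⟩⟩ := h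
  exact ⟨U.Q.tensor (M.tensor V.Q),
    ⟨((a.conjugate hV.equivalence.symm hU.equivalence.symm).ofNatIsoLeft
      (RBimod.tensorLeftTriple U.Q M V.Q).symm).ofNatIsoRight
      (RBimod.tensorLeftTriple V.P Y U.P).symm⟩⟩

theorem fg_projective_right_sandwich_iff (hU : U.IsStrict) (hV : V.IsStrict) (Y : RBimod S R) :
    (Module.Finite Rᵐᵒᵖ (V.P.tensor (Y.tensor U.P)) ∧
      Module.Projective Rᵐᵒᵖ (V.P.tensor (Y.tensor U.P))) ↔
    (Module.Finite Rᵐᵒᵖ Y ∧ Module.Projective Rᵐᵒᵖ Y) := by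
  refine ⟨fun h => ?_, fg_projective_right_sandwich hU hV⟩
  -- Y is recovered by sandwiching again with V' and U', the bimodules of the swapped contexts, so
  -- the direct implication applies once more.
  obtain ⟨e⟩ := (nonempty_iso_sandwich_iff hU hV Y _).2 ⟨RBimod.Iso.refl _⟩
  obtain ⟨M, ⟨a⟩⟩ := (fg_projective_right_iff_exists _).1
    (fg_projective_right_sandwich hU.swap hV.swap h)
  exact (fg_projective_right_iff_exists Y).2
    ⟨M, ⟨a.ofNatIsoRight (RBimod.tensorLeftCongr e.symm)⟩⟩

/-- Projectivity of X over S and Λ ≅ Hom_S(X, S) form the first duality. Projectivity of X over R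
and the other isomorphism form the second, once V' and U' are moved across. -/
theorem frobeniusConditionX_iff (hU : U.IsStrict) (hV : V.IsStrict) :
    FrobeniusConditionX X Λ U V ↔ Nonempty (DualPairing Λ X) ∧
      Nonempty (DualPairing X (V.P.tensor (Λ.tensor U.P))) := by
  rw [DualPairing.nonempty_iff_rightDual, DualPairing.nonempty_iff_leftDual,
    ← nonempty_iso_sandwich_iff hU hV]
  constructor
  · rintro ⟨⟨hl, hr⟩, ⟨e⟩, ⟨e'⟩⟩
    exact ⟨⟨hr, ⟨e⟩⟩, hl, ⟨e.trans e'⟩⟩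
  · rintro ⟨⟨hr, ⟨e⟩⟩, hl, ⟨e'⟩⟩
    exact ⟨⟨hl, hr⟩, ⟨e⟩, ⟨e.symm.trans e'⟩⟩

/-- The same two dualities, each read from its other member; projectivity of V ⊗ Λ ⊗ U over R on the
right is equivalent to that of Λ. -/
theorem frobeniusConditionΛ_iff (hU : U.IsStrict) (hV : V.IsStrict) :
    FrobeniusConditionΛ X Λ U V ↔ Nonempty (DualPairing Λ X) ∧
      Nonempty (DualPairing X (V.P.tensor (Λ.tensor U.P))) := by
  rw [DualPairing.nonempty_iff_leftDual, DualPairing.nonempty_iff_rightDual,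
    fg_projective_right_sandwich_iff hU hV]
  constructor
  · rintro ⟨⟨hl, hr⟩, ⟨e⟩, ⟨e'⟩⟩
    exact ⟨⟨hl, ⟨e⟩⟩, hr, ⟨e.trans e'⟩⟩
  · rintro ⟨⟨hl, ⟨e⟩⟩, hr, ⟨e'⟩⟩
    exact ⟨⟨hl, hr⟩, ⟨e⟩, ⟨e.symm.trans e'⟩⟩

theorem frobeniusConditionX_iff_left (hU : U.IsStrict) (hV : V.IsStrict) :
    FrobeniusConditionX X Λ U V ↔ IsFrobeniusPair Λ.tensorLeftFunctor X.tensorLeftFunctor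
      U.P.tensorLeftFunctor V.P.tensorLeftFunctor := by
  rw [frobeniusConditionX_iff hU hV, DualPairing.nonempty_iff_adjunction,
    DualPairing.nonempty_iff_adjunction]
  refine and_congr_right fun _ => ?_
  exact ⟨fun ⟨a⟩ => ⟨a.ofNatIsoRight (RBimod.tensorLeftTriple V.P Λ U.P)⟩,
    fun ⟨a⟩ => ⟨a.ofNatIsoRight (RBimod.tensorLeftTriple V.P Λ U.P).symm⟩⟩

theorem frobeniusConditionX_iff_right (hU : U.IsStrict) (hV : V.IsStrict) :
    FrobeniusConditionX X Λ U V ↔ IsFrobeniusPair X.tensorRightFunctor Λ.tensorRightFunctor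
      U.P.tensorRightFunctor V.P.tensorRightFunctor := by
  rw [frobeniusConditionX_iff_left hU hV]
  refine and_congr ?_ ?_
  · rw [← DualPairing.nonempty_iff_adjunction, DualPairing.nonempty_iff_adjunction_right]
  · refine (nonempty_adjunction_conjugate_iff hV.equivalence hU.equivalence
      X.tensorLeftFunctor Λ.tensorLeftFunctor).symm.trans ?_
    -- With U and V moved next to X, the second duality has Λ as its second member; on right modules
    -- it makes - ⊗ Λ left adjoint to - ⊗ U ⊗ X ⊗ V.
    trans Nonempty (DualPairing ((U.P.tensor X).tensor V.P) Λ)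
    · rw [DualPairing.nonempty_iff_adjunction]
      exact ⟨fun ⟨a⟩ => ⟨a.ofNatIsoLeft (RBimod.tensorLeftTriple' U.P X V.P).symm⟩,
        fun ⟨a⟩ => ⟨a.ofNatIsoLeft (RBimod.tensorLeftTriple' U.P X V.P)⟩⟩
    · rw [DualPairing.nonempty_iff_adjunction_right]
      exact ⟨fun ⟨a⟩ => ⟨a.ofNatIsoRight (RBimod.tensorRightTriple U.P X V.P)⟩,
        fun ⟨a⟩ => ⟨a.ofNatIsoRight (RBimod.tensorRightTriple U.P X V.P).symm⟩⟩

end Conditions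

/-- A partner for each element is chosen arbitrarily; single-valuedness modulo `s'` makes the choice
irrelevant. Describing the bijection by a relation on representatives is how every correspondence
below is built. -/
theorem exists_quotient_equiv {α β : Type*} (s : Setoid α) (s' : Setoid β) (r : α → β → Prop)
    (total : ∀ a, ∃ b, r a b) (surj : ∀ b, ∃ a, r a b)
    (congr_left : ∀ a a' b, s a a' → r a b → r a' b)
    (congr_right : ∀ a b b', s' b b' → r a b → r a b')
    (inj : ∀ a a' b, r a b → r a' b → s a a') (fun_like : ∀ a b b', r a b → r a b' → s' b b') :
    ∃ Φ : Quotient s ≃ Quotient s', ∀ a b, Φ (Quotient.mk s a) = Quotient.mk s' b ↔ r a b := by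
  choose f hf using total
  let φ : Quotient s → Quotient s' := Quotient.lift (fun a => Quotient.mk s' (f a))
    fun a a' h => Quotient.sound (fun_like a' _ _ (congr_left a a' _ h (hf a)) (hf a'))
  have hφ (a : α) (b : β) : φ (Quotient.mk s a) = Quotient.mk s' b ↔ r a b :=
    ⟨fun h => congr_right a _ _ (Quotient.exact h) (hf a),
      fun h => Quotient.sound (fun_like a _ _ (hf a) h)⟩
  refine ⟨Equiv.ofBijective φ ⟨?_, ?_⟩, hφ⟩
  · rintro ⟨a⟩ ⟨a'⟩ h
    exact Quotient.sound (inj a a' (f a') ((hφ a (f a')).1 h) (hf a'))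
  · rintro ⟨b⟩
    obtain ⟨a, ha⟩ := surj b
    exact ⟨Quotient.mk s a, (hφ a b).2 ha⟩

/-! ### Fourtuples and Frobenius data up to isomorphism. -/

section Data

variable {R S : Type u} [Ring R] [Ring S]

namespace FrobeniusFourtuple

/-- The left module functors of a fourtuple. -/
def leftDatum (t : FrobeniusFourtuple R S) :
    FrobeniusDatum (ModuleCat.{u} R) (ModuleCat.{u} S) where
  F := t.Λ.tensorLeftFunctor
  G := t.X.tensorLeftFunctor
  α := t.U.P.tensorLeftFunctor
  β := t.V.P.tensorLeftFunctor
  equivα := t.strictU.isEquivalence_left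
  equivβ := t.strictV.isEquivalence_left
  frobenius := (frobeniusConditionX_iff_left t.strictU t.strictV).1 t.condition

/-- The right module functors of a fourtuple. -/
def rightDatum (t : FrobeniusFourtuple R S) :
    FrobeniusDatum (ModuleCat.{u} Rᵐᵒᵖ) (ModuleCat.{u} Sᵐᵒᵖ) where
  F := t.X.tensorRightFunctor
  G := t.Λ.tensorRightFunctor
  α := t.U.P.tensorRightFunctor
  β := t.V.P.tensorRightFunctor
  equivα := t.strictU.isEquivalence_right
  equivβ := t.strictV.isEquivalence_right
  frobenius := (frobeniusConditionX_iff_right t.strictU t.strictV).1 t.condition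

theorem exists_equiv_leftDatum (D : FrobeniusDatum (ModuleCat.{u} R) (ModuleCat.{u} S)) :
    ∃ t : FrobeniusFourtuple R S, D ≈ t.leftDatum := by
  obtain ⟨F, G, α, β, hα, hβ, hD⟩ := D
  obtain ⟨⟨a⟩, ⟨b⟩⟩ := hD
  -- All four functors are left adjoints: F by the first adjunction, G by the second, and α, β
  -- because they are equivalences.
  obtain ⟨Λ, ⟨eF⟩⟩ := exists_iso_tensorLeft a
  obtain ⟨X, ⟨eG⟩⟩ := exists_iso_tensorLeft b
  obtain ⟨P, ⟨eα⟩⟩ := exists_iso_tensorLeft α.asEquivalence.toAdjunction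
  obtain ⟨P', ⟨eβ⟩⟩ := exists_iso_tensorLeft β.asEquivalence.toAdjunction
  obtain ⟨U, hU, rfl⟩ := RBimod.exists_strict_of_isEquivalence (Functor.isEquivalence_of_iso eα)
  obtain ⟨V, hV, rfl⟩ := RBimod.exists_strict_of_isEquivalence (Functor.isEquivalence_of_iso eβ)
  exact ⟨⟨X, Λ, U, V, hU, hV, (frobeniusConditionX_iff_left hU hV).2
    (IsFrobeniusPair.of_iso ⟨⟨a⟩, ⟨b⟩⟩ eF eG eα eβ)⟩, ⟨eF⟩, ⟨eG⟩, ⟨eα⟩, ⟨eβ⟩⟩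

theorem exists_equiv_rightDatum (D : FrobeniusDatum (ModuleCat.{u} Rᵐᵒᵖ) (ModuleCat.{u} Sᵐᵒᵖ)) :
    ∃ t : FrobeniusFourtuple R S, D ≈ t.rightDatum := by
  obtain ⟨F, G, α, β, hα, hβ, hD⟩ := D
  obtain ⟨⟨a⟩, ⟨b⟩⟩ := hD
  obtain ⟨X, ⟨eF⟩⟩ := exists_iso_tensorRight a
  obtain ⟨Λ, ⟨eG⟩⟩ := exists_iso_tensorRight b
  obtain ⟨P, ⟨eα⟩⟩ := exists_iso_tensorRight α.asEquivalence.toAdjunction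
  obtain ⟨P', ⟨eβ⟩⟩ := exists_iso_tensorRight β.asEquivalence.toAdjunction
  -- Strict contexts are built from equivalences of left modules, so invertibility is first
  -- transferred from right to left.
  obtain ⟨U, hU, rfl⟩ := RBimod.exists_strict_of_isEquivalence (RBimod.isEquivalence_left_iff.2
    (RBimod.isEquivalence_right_iff.1 (Functor.isEquivalence_of_iso eα)))
  obtain ⟨V, hV, rfl⟩ := RBimod.exists_strict_of_isEquivalence (RBimod.isEquivalence_left_iff.2
    (RBimod.isEquivalence_right_iff.1 (Functor.isEquivalence_of_iso eβ)))
  exact ⟨⟨X, Λ, U, V, hU, hV, (frobeniusConditionX_iff_right hU hV).2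
    (IsFrobeniusPair.of_iso ⟨⟨a⟩, ⟨b⟩⟩ eF eG eα eβ)⟩, ⟨eF⟩, ⟨eG⟩, ⟨eα⟩, ⟨eβ⟩⟩

theorem equiv_of_iso {t t' : FrobeniusFourtuple R S} (hX : Nonempty (RBimod.Iso t.X t'.X))
    (hΛ : Nonempty (RBimod.Iso t.Λ t'.Λ)) (hU : Nonempty (RBimod.Iso t.U.P t'.U.P))
    (hV : Nonempty (RBimod.Iso t.V.P t'.V.P)) : t ≈ t' :=
  ⟨hX, hΛ, MoritaContext.isomorphic_of_iso t.strictU t'.strictU hU.some,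
    MoritaContext.isomorphic_of_iso t.strictV t'.strictV hV.some⟩

theorem leftDatum_equiv_iff {t t' : FrobeniusFourtuple R S} :
    t.leftDatum ≈ t'.leftDatum ↔ t ≈ t' := by
  constructor
  · rintro ⟨hΛ, hX, hU, hV⟩
    rw [leftDatum, leftDatum, RBimod.nonempty_tensorLeft_iso_iff] at hΛ hX hU hV
    exact equiv_of_iso hX hΛ hU hV
  · rintro ⟨⟨eX⟩, ⟨eΛ⟩, ⟨eU, -⟩, ⟨eV, -⟩⟩
    exact ⟨⟨RBimod.tensorLeftCongr eΛ⟩, ⟨RBimod.tensorLeftCongr eX⟩,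
      ⟨RBimod.tensorLeftCongr eU⟩, ⟨RBimod.tensorLeftCongr eV⟩⟩

theorem rightDatum_equiv_iff {t t' : FrobeniusFourtuple R S} :
    t.rightDatum ≈ t'.rightDatum ↔ t ≈ t' := by
  constructor
  · rintro ⟨hX, hΛ, hU, hV⟩
    rw [rightDatum, rightDatum, RBimod.nonempty_tensorRight_iso_iff] at hΛ hX hU hV
    exact equiv_of_iso hX hΛ hU hV
  · rintro ⟨⟨eX⟩, ⟨eΛ⟩, ⟨eU, -⟩, ⟨eV, -⟩⟩
    exact ⟨⟨RBimod.tensorRightCongr eX⟩, ⟨RBimod.tensorRightCongr eΛ⟩,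
      ⟨RBimod.tensorRightCongr eU⟩, ⟨RBimod.tensorRightCongr eV⟩⟩

/-- Λ ⊗ - is left adjoint to X ⊗ -, and adjoints are unique. Hence the correspondence of single
functors does not depend on the chosen fourtuple. -/
theorem nonempty_iso_iff (t t' : FrobeniusFourtuple R S) :
    Nonempty (RBimod.Iso t.X t'.X) ↔ Nonempty (RBimod.Iso t.Λ t'.Λ) := by
  obtain ⟨a⟩ := t.leftDatum.frobenius.1
  obtain ⟨a'⟩ := t'.leftDatum.frobenius.1
  rw [← RBimod.nonempty_tensorLeft_iso_iff, ← RBimod.nonempty_tensorLeft_iso_iff]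
  exact ⟨fun ⟨e⟩ => ⟨(a.ofNatIsoRight e).leftAdjointUniq a'⟩,
    fun ⟨e⟩ => ⟨(a.ofNatIsoLeft e).rightAdjointUniq a'⟩⟩

end FrobeniusFourtuple

theorem exists_quotient_equiv_datum {C D : Type*} [Category C] [Category D]
    (d : FrobeniusFourtuple R S → FrobeniusDatum C D)
    (hd : ∀ t t', d t ≈ d t' ↔ t ≈ t') (surj : ∀ D, ∃ t, D ≈ d t) :
    ∃ Φ : Quotient (FrobeniusFourtuple.setoid R S) ≃ Quotient (FrobeniusDatum.setoid C D),
      ∀ t D, Φ (Quotient.mk _ t) = Quotient.mk _ D ↔ D ≈ d t :=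
  exists_quotient_equiv _ _ (fun t D => D ≈ d t) (fun t => ⟨d t, Setoid.refl _⟩) surj
    (fun t t' _ h h' => Setoid.trans h' ((hd t t').2 h))
    (fun _ _ _ h h' => Setoid.trans (Setoid.symm h) h')
    (fun t t' _ h h' => (hd t t').1 (Setoid.trans (Setoid.symm h) h'))
    (fun _ _ _ h h' => Setoid.trans h (Setoid.symm h'))

end Data

theorem theorem2p4 (R S : Type u) [Ring R] [Ring S] :
    -- the two conditions on fourtuples are equivalent
    (∀ (X : RBimod R S) (Λ : RBimod S R) (U : MoritaContext R R) (V : MoritaContext S S),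
      U.IsStrict → V.IsStrict →
        (FrobeniusConditionX X Λ U V ↔ FrobeniusConditionΛ X Λ U V)) ∧
    -- isomorphism classes of fourtuples, of left data and of right data correspond
    (∃ (Φ : Quotient (FrobeniusFourtuple.setoid R S) ≃
          Quotient (FrobeniusDatum.setoid (ModuleCat.{u} R) (ModuleCat.{u} S)))
        (Ψ : Quotient (FrobeniusFourtuple.setoid R S) ≃
          Quotient (FrobeniusDatum.setoid (ModuleCat.{u} Rᵐᵒᵖ) (ModuleCat.{u} Sᵐᵒᵖ))),
      (∀ (t : FrobeniusFourtuple R S)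
          (D : FrobeniusDatum (ModuleCat.{u} R) (ModuleCat.{u} S)),
        Φ (Quotient.mk _ t) = Quotient.mk _ D ↔
          Nonempty (D.F ≅ t.Λ.tensorLeftFunctor) ∧ Nonempty (D.G ≅ t.X.tensorLeftFunctor) ∧
          Nonempty (D.α ≅ t.U.P.tensorLeftFunctor) ∧
          Nonempty (D.β ≅ t.V.P.tensorLeftFunctor)) ∧
      (∀ (t : FrobeniusFourtuple R S)
          (D : FrobeniusDatum (ModuleCat.{u} Rᵐᵒᵖ) (ModuleCat.{u} Sᵐᵒᵖ)),
        Ψ (Quotient.mk _ t) = Quotient.mk _ D ↔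
          Nonempty (D.F ≅ t.X.tensorRightFunctor) ∧
          Nonempty (D.G ≅ t.Λ.tensorRightFunctor) ∧
          Nonempty (D.α ≅ t.U.P.tensorRightFunctor) ∧
          Nonempty (D.β ≅ t.V.P.tensorRightFunctor))) ∧
    -- the induced correspondence between the single functors on left and right modules
    ∃ Θ : Quotient (FrobeniusFunctor.setoid (ModuleCat.{u} R) (ModuleCat.{u} S)) ≃
        Quotient (FrobeniusFunctor.setoid (ModuleCat.{u} Rᵐᵒᵖ) (ModuleCat.{u} Sᵐᵒᵖ)),
      ∀ (F : FrobeniusFunctor (ModuleCat.{u} R) (ModuleCat.{u} S))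
        (F' : FrobeniusFunctor (ModuleCat.{u} Rᵐᵒᵖ) (ModuleCat.{u} Sᵐᵒᵖ)),
        Θ (Quotient.mk _ F) = Quotient.mk _ F' ↔
          ∃ t : FrobeniusFourtuple R S,
            Nonempty (F.1 ≅ t.Λ.tensorLeftFunctor) ∧
            Nonempty (F'.1 ≅ t.X.tensorRightFunctor) := by
  refine ⟨fun X Λ U V hU hV =>
    (frobeniusConditionX_iff hU hV).trans (frobeniusConditionΛ_iff hU hV).symm, ?_, ?_⟩
  · obtain ⟨Φ, hΦ⟩ := exists_quotient_equiv_datum FrobeniusFourtuple.leftDatum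
      (fun _ _ => FrobeniusFourtuple.leftDatum_equiv_iff)
      (FrobeniusFourtuple.exists_equiv_leftDatum (R := R) (S := S))
    obtain ⟨Ψ, hΨ⟩ := exists_quotient_equiv_datum FrobeniusFourtuple.rightDatum
      (fun _ _ => FrobeniusFourtuple.rightDatum_equiv_iff)
      (FrobeniusFourtuple.exists_equiv_rightDatum (R := R) (S := S))
    exact ⟨Φ, Ψ, hΦ, hΨ⟩
  · refine exists_quotient_equiv _ _ _ ?_ ?_ ?_ ?_ ?_ ?_
    · rintro ⟨F, G, α, β, hα, hβ, h⟩
      -- A choice of G, α, β yields a fourtuple, whose right-module functor - ⊗ X is the partner of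
      -- F.
      obtain ⟨t, eF, -⟩ := FrobeniusFourtuple.exists_equiv_leftDatum ⟨F, G, α, β, hα, hβ, h⟩
      let D := t.rightDatum
      exact ⟨⟨D.F, D.G, D.α, D.β, D.equivα, D.equivβ, D.frobenius⟩, t, eF, ⟨Iso.refl _⟩⟩
    · rintro ⟨F, G, α, β, hα, hβ, h⟩
      obtain ⟨t, eF, -⟩ := FrobeniusFourtuple.exists_equiv_rightDatum ⟨F, G, α, β, hα, hβ, h⟩
      let D := t.leftDatum
      exact ⟨⟨D.F, D.G, D.α, D.β, D.equivα, D.equivβ, D.frobenius⟩, t, ⟨Iso.refl _⟩, eF⟩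
    · rintro F F₁ F' ⟨e⟩ ⟨t, ⟨a⟩, ha⟩
      exact ⟨t, ⟨e.symm ≪≫ a⟩, ha⟩
    · rintro F F' F₁' ⟨e⟩ ⟨t, ha, ⟨a⟩⟩
      exact ⟨t, ha, ⟨e.symm ≪≫ a⟩⟩
    · rintro F F₁ F' ⟨t, ⟨a⟩, ⟨a'⟩⟩ ⟨t', ⟨b⟩, ⟨b'⟩⟩
      -- Two fourtuples with the same F' have isomorphic X, hence isomorphic Λ, hence isomorphic F.
      obtain ⟨e⟩ := (t.nonempty_iso_iff t').1
        (RBimod.nonempty_tensorRight_iso_iff.1 ⟨a'.symm ≪≫ b'⟩)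
      exact ⟨a ≪≫ RBimod.tensorLeftCongr e ≪≫ b.symm⟩
    · rintro F F' F₁' ⟨t, ⟨a⟩, ⟨a'⟩⟩ ⟨t', ⟨b⟩, ⟨b'⟩⟩
      obtain ⟨e⟩ := (t.nonempty_iso_iff t').2
        (RBimod.nonempty_tensorLeft_iso_iff.1 ⟨a.symm ≪≫ b⟩)
      exact ⟨a' ≪≫ RBimod.tensorRightCongr e ≪≫ b'.symm⟩
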